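/- **Vocabulary.** Fix a reserved vocabulary with a fixed interpretation: arithmetic functors (real functions), binary comparison predicates on $\mathbb R$, and distribution functors $d$. For numbers $v\in\mathbb R^n$ in a Borel domain, $d(v)$ is a Borel probability distribution on $\mathbb R$, depending measurably on $v$, that is carried by a sample space which also varies measurably with $v$. Among these are the predicate $=:=$ (equality), $flip(p)$ (value $1$ with probability $p$, otherwise $0$) and $finite([p_1:1,\dots,p_n:n])$ (value $i$ with probability $p_i$, and $0$ with the remaining probability). **Programs.** A DC-ProbLog program $P$ is a countable set of ground statements: probabilistic facts $p::a$, annotated disjunctions $p_1::a_1;\dots;p_n::a_n\leftarrow\beta$, distributional clauses $\tau\sim d(t_1,\dots,t_n)\leftarrow\beta$ and normal clauses $a\leftarrow\beta$, where $\beta$ is a finite conjunction of literals over regular atoms and comparison atoms ($t_1\bowtie t_2$ or $delta\_interval(\tau,w)$, $w\in\mathbb Q$). Its AD-free form replaces $p::a$ by $\nu\sim flip(p)$ and $a\leftarrow \nu=:=1$, and replaces an annotated disjunction by $\nu\sim finite([p_1:1,\dots,p_n:n])$ and $a_i\leftarrow\nu=:=i,\beta$ for all $i$, with a fresh term $\nu$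 for each statement. Its DF-PLP program $P'$ is then obtained as follows. * Each distributional clause $\tau\sim\delta\leftarrow\beta$, with each choice of random variables for the random terms in $\delta$, gives a random variable $\nu$ of $\tau$ with distribution term the so instantiated $\delta$, and clauses $rv(\tau,\nu)\leftarrow\dots$ whose body consists of the atoms $rv(\rho,\nu_\rho)$ for the random terms $\rho$ in $\delta$ and the contextualized $\beta$. * Each normal clause $a\leftarrow\beta$ gives the clauses $a\leftarrow$ (contextualized $\beta$). * To contextualize $\beta$ is to replace, in every possible way, each random term $\rho$ in its comparison atoms by a random variable $\nu_\rho$ of $\rho$ and to add $rv(\rho,\nu_\rho)$ to the conjunction. **Semantics.** Let $\varepsilon$ assign a width $\varepsilon(\nu,w)$ to every random variable $\nu$ and $w\in\mathbb Q$. Under an assignment $\omega$ of values to the random variables, a comparison $t_1\bowtie t_2$ has its usual truth value, and $delta\_interval(\nu,w)$ means $\omega_\nu=w$ if the sample space of $\nu$ is countable, and $w-\varepsilon(\nu,w)\le\omega_\nu\le w+\varepsilon(\nu,w)$ otherwise. $M_\omega$ is the set of true atoms of the well-founded model of the normal logic program that consists of the clauses of $P'$ and, as facts, the measurable comparison atoms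 over the random variables that hold under $\omega$. $P$ is *valid* (for $\varepsilon$) if: * each random term has finitely many distributional clauses, no two of which have bodies that are true in the same $M_\omega$ ($\omega$ admissible); * the ancestor relations on random terms and on random variables are acyclic, with finitely many ancestors each; * the random variables are countably many, their distribution terms mention random variables only and depend measurably on them, and replacing ancestors by values in their sample spaces always gives a well-defined distribution; * all comparison atoms in clauses of $P'$ are measurable comparisons of random variables; * the well-founded model is two-valued for every admissible $\omega$. Here $\omega$ is *admissible* if each $\omega_\nu$ lies in the sample space of $\nu$. The distributional facts of a valid program define a joint law $P_V$ of the random variables (the Bayesian network in which each $\nu$ has its distribution given its parents). For ground atoms of $P'$ one sets $$P_\varepsilon(\mu=q\mid E=e)=\frac{P_V(\{\omega:\ M_\omega \text{ gives } \mu \text{ the value } q \text{ and every }\eta\in E\text{ the value } e(\eta)\})}{P_V(\{\omega:\ M_\omega \text{ gives every }\eta\in E\text{ the value } e(\eta)\})}.$$ For evidence that may have probability zero, $p$ is the conditional probability $P(\mu=q\mid E=e)$ if $P_\varepsilon(\mu=q\mid E=e)\to p$ as the widths $\varepsilon$ tend to $0$ through positive values along some filter $\ell$ (i.e. in some prescribed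 mode, joint or iterated), with $P_\varepsilon(E=e)\ne0$ eventually. **Formulas and labels.** Let $Q,E$ be finite sets of ground atoms of $P'$ (comparison atoms among them being measurable comparisons of random variables of $P'$) and $e:E\to\{\bot,\top\}$. The *relevant ground program* $P_g$ consists of the clauses of $P'$ met in backward chaining from $Q\cup E$ and of the distributional facts for the random variables in the comparison atoms that are met and for their ancestors. Assume that it has finitely many clauses. Let $\phi$ be the conjunction of * Clark's completion of all non-comparison atoms of $P_g$, $Q$ and $E$, * the loop formulas of $P_g$ (vacuous if there are no cycles through positive literals), and * the literals that assert $E=e$. For $\mu\in Q$ and a truth value $q$, let $\phi_q$ be the literal $\mu$ if $q=\top$ and $\lnot\mu$ if $q=\bot$. The label $\alpha_\varepsilon(\psi)$ of a propositional formula $\psi$ is the sum, over the satisfying assignments to the variables of $\psi$, of the product of the labels of their literals. Here a comparison literal has as label the indicator function of its truth under $\omega$, and every other literal has label $1$. $\mathbb E$ is the expectation under the joint law of the random variables of $P_g$. **Theorem.** Let $P$ be a DC-ProbLog program, and let $Q,E,e$ be as above with $P_g$ finite, $\mu\in Q$ and $q\in\{\bot,\top\}$. 1. If $P$ is valid for $\varepsilon$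 and $P_\varepsilon(E=e)\neq 0$, then $\alpha_\varepsilon(\phi)$ and $\alpha_\varepsilon(\phi\wedge\phi_q)$ are integrable, $\mathbb E[\alpha_\varepsilon(\phi)]\ne0$ and $$P_\varepsilon(\mu=q\mid E=e)=\frac{\mathbb E[\alpha_\varepsilon(\phi\wedge\phi_q)]}{\mathbb E[\alpha_\varepsilon(\phi)]}.$$ 2. If $P$ is valid for all $\varepsilon$ eventually along $\ell$ and $p$ is the conditional probability $P(\mu=q\mid E=e)$ of possibly zero-probability evidence, the limit being taken along $\ell$, then $$\lim_{\ell}\ \frac{\mathbb E[\alpha_\varepsilon(\phi\wedge\phi_q)]}{\mathbb E[\alpha_\varepsilon(\phi)]}=p.$$ -/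

import Mathlib

open MeasureTheory Filter Topology

namespace DCProbLog

universe u v

/-! ## Built-in vocabulary -/

/-- The reserved vocabulary together with its fixed interpretation, which is left to the designer of
a concrete system: distribution functors, arithmetic functors and comparison predicates.  A functor
symbol may be used with any number of arguments.  The distribution functor `d` applied to the
numbers `v` denotes a distribution when `v ∈ dom d n`; `law d n v` is then that distribution and
`space d n v` its sample space.  The functors `flip` and `finite` and the comparison `=:=`, which
the elimination of probabilistic facts and annotated disjunctions uses, have their usual
meaning. -/
structure Vocabulary where
  Dist : Type
  Arith : Type
  Cmp : Type
  arith : Arith → (n : ℕ) → (Fin n → ℝ) → ℝ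
  cmp : Cmp → ℝ → ℝ → Prop
  dom : Dist → (n : ℕ) → Set (Fin n → ℝ)
  law : Dist → (n : ℕ) → (Fin n → ℝ) → Measure ℝ
  space : Dist → (n : ℕ) → (Fin n → ℝ) → Set ℝ
  law_prob : ∀ d n, ∀ v ∈ dom d n, IsProbabilityMeasure (law d n v)
  law_space : ∀ d n, ∀ v ∈ dom d n, law d n v (space d n v)ᶜ = 0
  measurableSet_dom : ∀ d n, MeasurableSet (dom d n)
  measurable_law : ∀ d n, Measurable fun v : dom d n => law d n v
  measurableSet_space : ∀ d n,
    MeasurableSet {p : (Fin n → ℝ) × ℝ | p.1 ∈ dom d n ∧ p.2 ∈ space d n p.1}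
  /-- the comparison predicate `=:=` -/
  eqv : Cmp
  eqv_iff : ∀ x y, cmp eqv x y ↔ x = y
  /-- `flip(p)`: the value `1` with probability `p` and `0` otherwise -/
  flip : Dist
  flip_dom : ∀ n v, v ∈ dom flip n ↔ n = 1 ∧ ∀ i, v i ∈ Set.Icc (0 : ℝ) 1
  flip_law : ∀ p ∈ Set.Icc (0 : ℝ) 1, law flip 1 (fun _ => p) =
    ENNReal.ofReal p • Measure.dirac 1 + ENNReal.ofReal (1 - p) • Measure.dirac 0
  flip_space : ∀ p ∈ Set.Icc (0 : ℝ) 1, space flip 1 (fun _ => p) = {0, 1}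
  /-- `finite([p₁ : 1, …, pₙ : n])`, with arguments `p₁, …, pₙ`: the value `i` with probability
  `pᵢ`, and the value `0` with the probability that is left over, if any -/
  finite : Dist
  finite_dom : ∀ n v, v ∈ dom finite n ↔ (∀ i, 0 ≤ v i) ∧ ∑ i, v i ≤ 1
  finite_law : ∀ n, ∀ v ∈ dom finite n, law finite n v =
    ∑ i, ENNReal.ofReal (v i) • Measure.dirac (((i : ℕ) : ℝ) + 1) +
      ENNReal.ofReal (1 - ∑ i, v i) • Measure.dirac 0
  finite_space : ∀ n, ∀ v ∈ dom finite n, space finite n v =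
    {x | (∃ i : Fin n, x = ((i : ℕ) : ℝ) + 1) ∨ (x = 0 ∧ ∑ i, v i < 1)}

/-! ## Syntax -/

variable {L : Vocabulary} {X Y N T H K A : Type*}

/-- Ground arithmetic terms over numbers and (opaque) ground terms `x : X`. -/
inductive AExpr (L : Vocabulary) (X : Type u) : Type u
  | num (r : ℝ) : AExpr L X
  | term (x : X) : AExpr L X
  | app (f : L.Arith) (n : ℕ) (args : Fin n → AExpr L X) : AExpr L X

namespace AExpr

/-- The elements of `X` that occur in an arithmetic term. -/
def terms : AExpr L X → List X
  | num _ => []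
  | term x => [x]
  | app _ n args => (List.ofFn fun i : Fin n => (args i).terms).flatten

def map (σ : X → Y) : AExpr L X → AExpr L Y
  | num r => num r
  | term x => term (σ x)
  | app f n args => app f n fun i => (args i).map σ

/-- The value of an arithmetic term when each `x : X` has the value `ω x`. -/
def eval (ω : X → ℝ) : AExpr L X → ℝ
  | num r => r
  | term x => ω x
  | app f n args => L.arith f n fun i => (args i).eval ω

end AExpr

/-- Distribution terms `d(t₁, …, tₙ)`. -/
structure DistTerm (L : Vocabulary) (X : Type u) : Type u where
  functor : L.Dist
  n : ℕ
  args : Fin n → AExpr L X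

namespace DistTerm

def terms (δ : DistTerm L X) : List X := (List.ofFn fun i => (δ.args i).terms).flatten

def map (σ : X → Y) (δ : DistTerm L X) : DistTerm L Y := ⟨δ.functor, δ.n, fun i => (δ.args i).map σ⟩

def vals (δ : DistTerm L X) (ω : X → ℝ) : Fin δ.n → ℝ := fun i => (δ.args i).eval ω

end DistTerm

theorem AExpr.eval_congr {ω ω' : X → ℝ} (e : AExpr L X)
    (h : ∀ x ∈ e.terms, ω x = ω' x) : e.eval ω = e.eval ω' := by
  induction e with
  | num r => rfl
  | term x => exact h x (by simp [AExpr.terms])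
  | app f n args ih =>
    simp only [AExpr.eval]
    congr 1
    funext i
    refine ih i fun x hx => h x ?_
    simp only [AExpr.terms, List.mem_flatten, List.mem_ofFn]
    exact ⟨_, ⟨i, rfl⟩, hx⟩

theorem DistTerm.vals_congr {ω ω' : X → ℝ} (δ : DistTerm L X)
    (h : ∀ x ∈ δ.terms, ω x = ω' x) : δ.vals ω = δ.vals ω' := by
  funext i
  refine AExpr.eval_congr _ fun x hx => h x ?_
  simp only [DistTerm.terms, List.mem_flatten, List.mem_ofFn]
  exact ⟨_, ⟨i, rfl⟩, hx⟩

/-- Ground comparison atoms: `t₁ ⋈ t₂` for a comparison predicate `⋈`, and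
`delta_interval(x, w)` for a rational number `w`. -/
inductive CAtom (L : Vocabulary) (X : Type u) : Type u
  | cmp (p : L.Cmp) (l r : AExpr L X) : CAtom L X
  | delta (x : X) (w : ℚ) : CAtom L X

namespace CAtom

def terms : CAtom L X → List X
  | cmp _ l r => l.terms ++ r.terms
  | delta x _ => [x]

def map (σ : X → Y) : CAtom L X → CAtom L Y
  | cmp p l r => cmp p (l.map σ) (r.map σ)
  | delta x w => delta (σ x) w

end CAtom

/-- Ground atoms: non-comparison atoms `h : H` and comparison atoms over `X`. -/
inductive GAtom (L : Vocabulary) (X : Type u) (H : Type v) : Type (max u v)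
  | reg (h : H) : GAtom L X H
  | cmp (κ : CAtom L X) : GAtom L X H

namespace GAtom

/-- The elements of `X` with an interpreted occurrence in the atom. -/
def terms : GAtom L X H → List X
  | reg _ => []
  | cmp κ => κ.terms

def map (σ : X → Y) (τ : H → K) : GAtom L X H → GAtom L Y K
  | reg h => reg (τ h)
  | cmp κ => cmp (κ.map σ)

end GAtom

/-- A literal: an atom (`sign = true`) or its negation (`sign = false`). -/
structure Lit (α : Type v) where
  atom : α
  sign : Bool

/-- A conjunction of literals. -/
abbrev Body (L : Vocabulary) (X : Type u) (H : Type v) := List (Lit (GAtom L X H))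

namespace Body

def terms (β : Body L X H) : List X := (List.map (fun l => l.atom.terms) β).flatten

def rename (σ : X → Y) (τ : H → K) (β : Body L X H) : Body L Y K :=
  List.map (fun l => ⟨l.atom.map σ τ, l.sign⟩) β

end Body

/-- Ground normal clauses `head ← body` whose head is a non-comparison atom. -/
structure Clause (L : Vocabulary) (X : Type u) (H : Type v) where
  head : H
  body : Body L X H

/-! ## Two-valued well-founded models of ground normal logic programs -/

/-- Ground normal rules over an arbitrary set of atoms. -/
structure Rule (α : Type v) where
  head : α
  body : List (Lit α)

namespace Rule

variable {α : Type*}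

/-- `l` is true in the partial interpretation with true atoms `I.1` and false atoms `I.2`. -/
def litTrue (I : Set α × Set α) (l : Lit α) : Prop :=
  (l.sign = true ∧ l.atom ∈ I.1) ∨ (l.sign = false ∧ l.atom ∈ I.2)

def litFalse (I : Set α × Set α) (l : Lit α) : Prop :=
  (l.sign = true ∧ l.atom ∈ I.2) ∨ (l.sign = false ∧ l.atom ∈ I.1)

/-- The immediate consequences of a partial interpretation. -/
def consequences (R : Set (Rule α)) (I : Set α × Set α) : Set α :=
  {a | ∃ r ∈ R, r.head = a ∧ ∀ l ∈ r.body, litTrue I l}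

/-- `U` is unfounded with respect to the partial interpretation `I`. -/
def Unfounded (R : Set (Rule α)) (I : Set α × Set α) (U : Set α) : Prop :=
  ∀ r ∈ R, r.head ∈ U →
    (∃ l ∈ r.body, litFalse I l) ∨ (∃ l ∈ r.body, l.sign = true ∧ l.atom ∈ U)

/-- The greatest unfounded set. -/
def greatestUnfounded (R : Set (Rule α)) (I : Set α × Set α) : Set α :=
  ⋃₀ {U | Unfounded R I U}

/-- The operator whose least fixed point is the well-founded model. -/
def wfOperator (R : Set (Rule α)) : (Set α × Set α) →o (Set α × Set α) where
  toFun I := (consequences R I, greatestUnfounded R I)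
  monotone' := by
    intro I J hIJ
    have hT : ∀ l : Lit α, litTrue I l → litTrue J l := fun l h =>
      h.imp (fun h => ⟨h.1, hIJ.1 h.2⟩) (fun h => ⟨h.1, hIJ.2 h.2⟩)
    have hF : ∀ l : Lit α, litFalse I l → litFalse J l := fun l h =>
      h.imp (fun h => ⟨h.1, hIJ.2 h.2⟩) (fun h => ⟨h.1, hIJ.1 h.2⟩)
    constructor
    · rintro a ⟨r, hr, ha, hb⟩
      exact ⟨r, hr, ha, fun l hl => hT l (hb l hl)⟩
    · rintro a ⟨U, hU, ha⟩
      refine ⟨U, fun r hr hrU => (hU r hr hrU).imp ?_ id, ha⟩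
      rintro ⟨l, hl, h⟩
      exact ⟨l, hl, hF l h⟩

/-- The well-founded model: its true atoms and its false atoms. -/
def wellFoundedModel (R : Set (Rule α)) : Set α × Set α := (wfOperator R).lfp

/-- The well-founded model is two-valued. -/
def TwoValued (R : Set (Rule α)) : Prop := IsCompl (wellFoundedModel R).1 (wellFoundedModel R).2

end Rule

/-! ## Distributional databases -/

/-- A distributional database `{ν ∼ dist ν | ν ∈ vars}`. -/
structure Database (L : Vocabulary) (N : Type u) where
  vars : Set N
  dist : N → DistTerm L N

namespace Database

variable (D : Database L N)

/-- Value assignments to the random variables. -/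
abbrev Val := D.vars → ℝ

open Classical in
/-- A value assignment as a function on all terms (with the irrelevant value `0` off `vars`). -/
noncomputable def ext (ω : D.Val) : N → ℝ := fun ν => if h : ν ∈ D.vars then ω ⟨ν, h⟩ else 0

/-- `p` is a parent of `c`. -/
def Parent (p c : N) : Prop := p ∈ D.vars ∧ c ∈ D.vars ∧ p ∈ (D.dist c).terms

def Ancestor : N → N → Prop := Relation.TransGen D.Parent

/-- The distribution of `ν` when the random variables have the values `ω`. -/
noncomputable def law (ν : N) (ω : N → ℝ) : Measure ℝ :=
  L.law (D.dist ν).functor (D.dist ν).n ((D.dist ν).vals ω)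

/-- The sample space of `ν` when the random variables have the values `ω`. -/
def space (ν : N) (ω : N → ℝ) : Set ℝ :=
  L.space (D.dist ν).functor (D.dist ν).n ((D.dist ν).vals ω)

/-- Every random variable has a value in its sample space. -/
def Admissible (ω : D.Val) : Prop := ∀ ν : D.vars, ω ν ∈ D.space ν (D.ext ω)

/-- Well-defined distributional databases. -/
structure WellDefined : Prop where
  countable : D.vars.Countable
  /-- distribution terms mention random variables only -/
  closed : ∀ ν ∈ D.vars, ∀ p ∈ (D.dist ν).terms, p ∈ D.vars
  finite_ancestors : ∀ ν ∈ D.vars, {a | D.Ancestor a ν}.Finite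
  acyclic : ∀ ν ∈ D.vars, ¬ D.Ancestor ν ν
  /-- replacing the parents by samples always results in a well-defined distribution -/
  dist_defined : ∀ ν ∈ D.vars, ∀ ω : N → ℝ, (∀ a, D.Ancestor a ν → ω a ∈ D.space a ω) →
    (D.dist ν).vals ω ∈ L.dom (D.dist ν).functor (D.dist ν).n
  dist_measurable : ∀ ν ∈ D.vars, Measurable (D.dist ν).vals

/-- `P` is the joint law of the random variables: on every finite set of random variables that is
closed under parents it factorizes as the Bayesian network described by the database.  The
factorization is written as a chain rule: the law on `S ∪ {ν}` is the law on `S` followed by the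
distribution of `ν` given its parents, all of which lie in `S`. -/
structure IsJointLaw (P : Measure D.Val) : Prop where
  prob : IsProbabilityMeasure P
  chain : ∀ (ν : D.vars) (S : Finset D.vars),
    (∀ c ∈ S, ∀ p : D.vars, D.Parent p c → p ∈ S) → (∀ p : D.vars, D.Parent p ν → p ∈ S) → ν ∉ S →
    ∀ (U : Set (S → ℝ)) (B : Set ℝ), MeasurableSet U → MeasurableSet B →
      P ({ω | S.restrict ω ∈ U} ∩ {ω | ω ν ∈ B}) =
        ∫⁻ ω in {ω | S.restrict ω ∈ U}, D.law ν (D.ext ω) B ∂P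

variable {D} in
/-- Parenthood as a relation on the random variables is well-founded. -/
theorem WellDefined.wellFounded (hD : D.WellDefined) :
    WellFounded fun p c : D.vars => D.Parent p c := by
  refine Subrelation.wf (r := InvImage (· < ·) fun ν : D.vars => {a | D.Ancestor a ν}.ncard) ?_
    (InvImage.wf _ wellFounded_lt)
  intro p c hpc
  refine Set.ncard_lt_ncard ?_ (hD.finite_ancestors c c.2)
  refine ⟨fun a ha => Relation.TransGen.tail ha hpc, fun hsub => ?_⟩
  exact hD.acyclic p p.2 (hsub (Relation.TransGen.single hpc))

variable {D} in
open Classical in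
/-- The distribution of `ν` given the other values can be sampled from a uniform variable. -/
theorem WellDefined.exists_sampler (hD : D.WellDefined) (ν : D.vars) :
    ∃ f : (N → ℝ) → unitInterval → ℝ, Measurable (Function.uncurry f) ∧
      ∀ x, (D.dist ν).vals x ∈ L.dom (D.dist ν).functor (D.dist ν).n →
        volume.map (f x) = D.law ν x := by
  set d := (D.dist ν).functor
  set n := (D.dist ν).n
  let g : (Fin n → ℝ) → Measure ℝ := fun v => if v ∈ L.dom d n then L.law d n v else Measure.dirac 0
  have hg : Measurable g := by
    refine measurable_of_restrict_of_restrict_compl (L.measurableSet_dom d n) ?_ ?_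
    · convert L.measurable_law d n using 1
      funext v
      simp [g, v.2]
    · have : (L.dom d n)ᶜ.domRestrict g = fun _ => Measure.dirac 0 := by
        funext v
        have := v.2
        simp only [Set.mem_compl_iff] at this
        simp [g, this]
      rw [this]
      exact measurable_const
  let κ : ProbabilityTheory.Kernel (N → ℝ) ℝ :=
    ⟨fun x => g ((D.dist ν).vals x), hg.comp (hD.dist_measurable ν ν.2)⟩
  have hκ : ProbabilityTheory.IsMarkovKernel κ := by
    refine ⟨fun x => ?_⟩
    change IsProbabilityMeasure (g _)
    by_cases h : (D.dist ν).vals x ∈ L.dom d n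
    · simp only [g, if_pos h]; exact L.law_prob _ _ _ h
    · simp only [g, if_neg h]; infer_instance
  obtain ⟨f, hf, hfκ⟩ := κ.exists_measurable_map_eq_unitInterval
  refine ⟨f, hf, fun x hx => ?_⟩
  rw [hfκ]
  change g _ = _
  simp only [g]
  rw [if_pos hx]
  rfl

variable {D} in
/-- A well-defined distributional database has a joint law. -/
theorem WellDefined.exists_isJointLaw (hD : D.WellDefined) : ∃ P, D.IsJointLaw P := by
  classical
  choose f hf hfl using hD.exists_sampler
  have wf := hD.wellFounded
  let I := unitInterval
  let S : D.vars → (D.vars → I) → ℝ := wf.fix fun ν rec u =>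
    f ν (fun m => if h : ∃ hm : m ∈ D.vars, D.Parent m ν then rec ⟨m, h.1⟩ h.2 u else 0) (u ν)
  let pv : D.vars → (D.vars → I) → N → ℝ := fun ν u m =>
    if h : ∃ hm : m ∈ D.vars, D.Parent m ν then S ⟨m, h.1⟩ u else 0
  have hS : ∀ ν u, S ν u = f ν (pv ν u) (u ν) := by
    intro ν u
    simp only [S, pv]
    rw [wf.fix_eq]
  -- measurability
  have hSm : ∀ ν, Measurable (S ν) := by
    intro ν
    induction ν using wf.induction with
    | _ ν ih =>
      have hpv : Measurable (pv ν) := by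
        refine measurable_pi_iff.2 fun m => ?_
        by_cases h : ∃ hm : m ∈ D.vars, D.Parent m ν
        · simp only [pv, dif_pos h]; exact ih ⟨m, h.1⟩ h.2
        · simp only [pv, dif_neg h]; exact measurable_const
      have : S ν = fun u => Function.uncurry (f ν) (pv ν u, u ν) := by
        funext u; rw [hS]; rfl
      rw [this]
      exact (hf ν).comp (hpv.prodMk (measurable_pi_apply ν))
  have hpvm : ∀ ν, Measurable (pv ν) := by
    intro ν
    refine measurable_pi_iff.2 fun m => ?_
    by_cases h : ∃ hm : m ∈ D.vars, D.Parent m ν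
    · simp only [pv, dif_pos h]; exact hSm _
    · simp only [pv, dif_neg h]; exact measurable_const
  let Φ : (D.vars → I) → D.Val := fun u ν => S ν u
  have hΦ : Measurable Φ := measurable_pi_iff.2 hSm
  -- values depend only on the coordinates in closed sets
  have hdep : ∀ K : Set D.vars, (∀ c ∈ K, ∀ p : D.vars, D.Parent p c → p ∈ K) →
      ∀ u u' : D.vars → I, (∀ i ∈ K, u i = u' i) → ∀ ν ∈ K, S ν u = S ν u' := by
    intro K hK u u' huu ν
    induction ν using wf.induction with
    | _ ν ih =>
      intro hν
      rw [hS, hS, huu ν hν]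
      congr 1
      funext m
      by_cases h : ∃ hm : m ∈ D.vars, D.Parent m ν
      · simp only [pv, dif_pos h]; exact ih ⟨m, h.1⟩ h.2 (hK ν hν ⟨m, h.1⟩ h.2)
      · simp only [pv, dif_neg h]
  have hpvv : ∀ (ν : D.vars) u, (D.dist ν).vals (pv ν u) = (D.dist ν).vals (D.ext (Φ u)) := by
    intro ν u
    refine DistTerm.vals_congr _ fun m hm => ?_
    have hmv := hD.closed ν ν.2 m hm
    have h : ∃ hm : m ∈ D.vars, D.Parent m ν := ⟨hmv, hmv, ν.2, hm⟩
    simp only [pv, dif_pos h, ext, dif_pos hmv, Φ]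
  let μ : Measure (D.vars → I) := Measure.infinitePi fun _ => volume
  -- independence of one coordinate from finitely many others
  have hind : ∀ (K : Finset D.vars) (ν : D.vars), ν ∉ K → ∀ V : Set ((K → I) × I),
      MeasurableSet V → μ {u | (K.restrict u, u ν) ∈ V} =
        ∫⁻ u, volume {t : I | (K.restrict u, t) ∈ V} ∂μ := by
    intro K ν hν V hV
    have hi : ProbabilityTheory.iIndepFun (fun (i : D.vars) (u : D.vars → I) => u i) μ :=
      ProbabilityTheory.iIndepFun_infinitePi (X := fun _ ω => ω) (by fun_prop)
    have h2 := hi.indepFun_finset K {ν} (by simpa using hν) (by fun_prop)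
    have h3 : ProbabilityTheory.IndepFun (fun u : D.vars → I => K.restrict u) (fun u => u ν) μ :=
      h2.comp (φ := id) (ψ := fun v : (({ν} : Finset D.vars) → I) => v ⟨ν, by simp⟩)
        measurable_id (measurable_pi_apply _)
    have hr : Measurable fun u : D.vars → I => K.restrict u := by
      exact measurable_pi_iff.2 fun i => measurable_pi_apply _
    have hm : μ.map (fun u => u ν) = volume := Measure.infinitePi_map_eval _ ν
    have h4 := (ProbabilityTheory.indepFun_iff_map_prod_eq_prod_map_map hr.aemeasurable
      (measurable_pi_apply ν).aemeasurable).1 h3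
    rw [hm] at h4
    have h5 : μ {u | (K.restrict u, u ν) ∈ V} =
        (μ.map fun u => (K.restrict u, u ν)) V := by
      rw [Measure.map_apply (hr.prodMk (measurable_pi_apply ν)) hV]; rfl
    rw [h5, h4, Measure.prod_apply hV, lintegral_map (measurable_measure_prodMk_left hV) hr]
    rfl
  -- chain rule in terms of the sampler
  have hchain : ∀ (ν : D.vars) (K : Finset D.vars),
      (∀ c ∈ K, ∀ p : D.vars, D.Parent p c → p ∈ K) → (∀ p : D.vars, D.Parent p ν → p ∈ K) →
      ν ∉ K → ∀ W : Set ((K → ℝ) × (N → ℝ) × ℝ), MeasurableSet W →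
      μ {u | (K.restrict (Φ u), pv ν u, S ν u) ∈ W} =
        ∫⁻ u, volume.map (f ν (pv ν u)) {y | (K.restrict (Φ u), pv ν u, y) ∈ W} ∂μ := by
    intro ν K hK hp hν W hW
    let e : (K → I) → D.vars → I := fun v i => if h : i ∈ K then v ⟨i, h⟩ else 0
    have he : Measurable e := by
      refine measurable_pi_iff.2 fun i => ?_
      by_cases h : i ∈ K
      · simp only [e, dif_pos h]; exact measurable_pi_apply _
      · simp only [e, dif_neg h]; exact measurable_const
    have heK : ∀ u : D.vars → I, ∀ i ∈ (K : Set D.vars), e (K.restrict u) i = u i := by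
      intro u i hi
      have hi' : i ∈ K := hi
      simp only [e, dif_pos hi']
      rfl
    have hSe : ∀ u : D.vars → I, ∀ i ∈ K, S i (e (K.restrict u)) = S i u := fun u i hi =>
      hdep K hK _ _ (heK u) i hi
    have hre : ∀ u, K.restrict (Φ (e (K.restrict u))) = K.restrict (Φ u) := by
      intro u; funext i; exact hSe u i i.2
    have hpe : ∀ u, pv ν (e (K.restrict u)) = pv ν u := by
      intro u; funext m
      by_cases h : ∃ hm : m ∈ D.vars, D.Parent m ν
      · simp only [pv, dif_pos h]; exact hSe u ⟨m, h.1⟩ (hp ⟨m, h.1⟩ h.2)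
      · simp only [pv, dif_neg h]
    have hrm : Measurable fun u : D.Val => K.restrict u := 
      measurable_pi_iff.2 fun i => measurable_pi_apply _
    let F : (K → I) × I → (K → ℝ) × (N → ℝ) × ℝ := fun vt =>
      (K.restrict (Φ (e vt.1)), pv ν (e vt.1), f ν (pv ν (e vt.1)) vt.2)
    have hF : Measurable F := by
      refine (hrm.comp (hΦ.comp (he.comp measurable_fst))).prodMk
        (((hpvm ν).comp (he.comp measurable_fst)).prodMk ?_)
      exact (hf ν).comp (((hpvm ν).comp (he.comp measurable_fst)).prodMk measurable_snd)
    have := hind K ν hν (F ⁻¹' W) (hF hW)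
    convert this using 1
    · congr 1
      ext u
      simp only [Set.mem_preimage, F, Set.mem_ofPred_eq, hre, hpe, ← hS]
    · refine lintegral_congr fun u => ?_
      rw [Measure.map_apply]
      · congr 1
        ext t
        simp only [Set.mem_preimage, F, Set.mem_ofPred_eq, hre, hpe]
        rfl
      · exact (hf ν).of_uncurry_left
      · have : Measurable fun y : ℝ => (K.restrict (Φ u), pv ν u, y) := by fun_prop
        exact this hW
  -- samples are admissible
  have hext : ∀ (ν : D.vars) u, D.ext (Φ u) ν = S ν u := by
    intro ν u
    simp only [ext, dif_pos ν.2, Φ]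
  have hvar : ∀ a (ν : D.vars), D.Ancestor a ν → a ∈ D.vars := by
    intro a ν h
    obtain ⟨b, hab, -⟩ := Relation.TransGen.head'_iff.1 h
    exact hab.1
  have hadm : ∀ ν : D.vars, (∀ᵐ u ∂μ, S ν u ∈ D.space ν (D.ext (Φ u))) ∧
      ∀ᵐ u ∂μ, (D.dist ν).vals (D.ext (Φ u)) ∈ L.dom (D.dist ν).functor (D.dist ν).n := by
    intro ν
    induction ν using wf.transGen.induction with
    | _ ν ih =>
      have hanc : ∀ a, D.Ancestor a ν → ∀ᵐ u ∂μ, D.ext (Φ u) a ∈ D.space a (D.ext (Φ u)) := by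
        intro a ha
        have hav := hvar a ν ha
        have hlift : ∀ a b, D.Ancestor a b → ∀ (ha : a ∈ D.vars) (hb : b ∈ D.vars),
            Relation.TransGen (fun p c : D.vars => D.Parent p c) ⟨a, ha⟩ ⟨b, hb⟩ := by
          intro a b hab
          induction hab with
          | single h => intro ha hb; exact Relation.TransGen.single h
          | tail _ h ih => intro ha hb; exact Relation.TransGen.tail (ih ha h.1) h
        have := (ih ⟨a, hav⟩ (hlift a ν ha hav ν.2)).1
        filter_upwards [this] with u hu
        rw [hext ⟨a, hav⟩]
        exact hu
      have hdom : ∀ᵐ u ∂μ,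
          (D.dist ν).vals (D.ext (Φ u)) ∈ L.dom (D.dist ν).functor (D.dist ν).n := by
        have := (ae_ball_iff (hD.finite_ancestors ν ν.2).countable).2 hanc
        filter_upwards [this] with u hu
        exact hD.dist_defined ν ν.2 _ hu
      refine ⟨?_, hdom⟩
      have hfin : ((↑) ⁻¹' {a | D.Ancestor a ν} : Set D.vars).Finite :=
        (hD.finite_ancestors ν ν.2).preimage Subtype.val_injective.injOn
      let K : Finset D.vars := hfin.toFinset
      have hKm : ∀ p : D.vars, p ∈ K ↔ D.Ancestor p ν := by
        intro p; simp [K]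
      let W : Set ((K → ℝ) × (N → ℝ) × ℝ) := {w |
        ¬ ((D.dist ν).vals w.2.1 ∈ L.dom (D.dist ν).functor (D.dist ν).n ∧
          w.2.2 ∈ L.space (D.dist ν).functor (D.dist ν).n ((D.dist ν).vals w.2.1))}
      have hW : MeasurableSet W := by
        have hm : Measurable fun w : (K → ℝ) × (N → ℝ) × ℝ => ((D.dist ν).vals w.2.1, w.2.2) :=
          ((hD.dist_measurable ν ν.2).comp (measurable_fst.comp measurable_snd)).prodMk
            (measurable_snd.comp measurable_snd)
        exact (hm (L.measurableSet_space _ _)).compl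
      have h := hchain ν K
        (fun c hc p hpc => (hKm p).2 (Relation.TransGen.head hpc ((hKm c).1 hc)))
        (fun p hp => (hKm p).2 (Relation.TransGen.single hp))
        (fun h => hD.acyclic ν ν.2 ((hKm ν).1 h)) W hW
      have h0 : ∫⁻ u, volume.map (f ν (pv ν u)) {y | (K.restrict (Φ u), pv ν u, y) ∈ W} ∂μ = 0 := by
        rw [← lintegral_zero (μ := μ)]
        refine lintegral_congr_ae ?_
        filter_upwards [hdom] with u hu
        rw [← hpvv] at hu
        rw [hfl ν _ hu]
        have : {y | (K.restrict (Φ u), pv ν u, y) ∈ W} =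
            (L.space (D.dist ν).functor (D.dist ν).n ((D.dist ν).vals (pv ν u)))ᶜ := by
          ext y
          simp only [W, Set.mem_ofPred_eq, Set.mem_compl_iff, hu, true_and]
        rw [this]
        exact L.law_space _ _ _ hu
      rw [h0] at h
      have h' : ∀ᵐ u ∂μ, (K.restrict (Φ u), pv ν u, S ν u) ∉ W := by
        rw [ae_iff]
        simpa using h
      filter_upwards [h'] with u hu
      simp only [W, Set.mem_ofPred_eq, not_not] at hu
      have := hu.2
      rw [hpvv] at this
      exact this
  refine ⟨μ.map Φ, ⟨Measure.isProbabilityMeasure_map hΦ.aemeasurable, ?_⟩⟩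
  intro ν K hK hp hν U B hU hB
  have hrm : Measurable fun u : D.Val => K.restrict u :=
    measurable_pi_iff.2 fun i => measurable_pi_apply _
  have hextm : Measurable D.ext := by
    refine measurable_pi_iff.2 fun m => ?_
    by_cases h : m ∈ D.vars
    · simp only [ext, dif_pos h]; exact measurable_pi_apply _
    · simp only [ext, dif_neg h]; exact measurable_const
  have hdomΦ : ∀ᵐ ω ∂(μ.map Φ),
      (D.dist ν).vals (D.ext ω) ∈ L.dom (D.dist ν).functor (D.dist ν).n := by
    have hmd : MeasurableSet {ω : D.Val |
        (D.dist ν).vals (D.ext ω) ∈ L.dom (D.dist ν).functor (D.dist ν).n} :=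
      ((hD.dist_measurable ν ν.2).comp hextm) (L.measurableSet_dom _ _)
    exact (ae_map_iff hΦ.aemeasurable hmd).2 (hadm ν).2
  have hmap : ∀ x, volume.map (f ν x) B = volume (Prod.mk x ⁻¹' (Function.uncurry (f ν) ⁻¹' B)) := by
    intro x
    rw [Measure.map_apply (hf ν).of_uncurry_left hB]
    rfl
  have hmeasB : Measurable fun x => volume.map (f ν x) B := by
    simp_rw [hmap]
    exact measurable_measure_prodMk_left (hf ν hB)
  have e1 : ∫⁻ ω in {ω | K.restrict ω ∈ U}, D.law ν (D.ext ω) B ∂(μ.map Φ) =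
      ∫⁻ ω in {ω | K.restrict ω ∈ U}, volume.map (f ν (D.ext ω)) B ∂(μ.map Φ) := by
    refine lintegral_congr_ae (ae_restrict_of_ae ?_)
    filter_upwards [hdomΦ] with ω hω
    rw [hfl ν _ hω]
  have e0 := setLIntegral_map (μ := μ) (hrm hU) (hmeasB.comp hextm) hΦ
  rw [e1]
  refine Eq.trans ?_ e0.symm
  have e4 : (μ.map Φ) ({ω | K.restrict ω ∈ U} ∩ {ω | ω ν ∈ B}) =
      μ (Φ ⁻¹' ({ω | K.restrict ω ∈ U} ∩ {ω | ω ν ∈ B})) := by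
    exact Measure.map_apply hΦ ((hrm hU).inter (measurable_pi_apply ν hB))
  rw [e4]
  have hW : MeasurableSet {w : (K → ℝ) × (N → ℝ) × ℝ | w.1 ∈ U ∧ w.2.2 ∈ B} :=
    (measurable_fst hU).inter ((measurable_snd.comp measurable_snd) hB)
  have h := hchain ν K hK hp hν _ hW
  have e2 : Φ ⁻¹' ({ω | K.restrict ω ∈ U} ∩ {ω | ω ν ∈ B}) =
      {u | (K.restrict (Φ u), pv ν u, S ν u) ∈
        {w : (K → ℝ) × (N → ℝ) × ℝ | w.1 ∈ U ∧ w.2.2 ∈ B}} := rfl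
  rw [e2, h, ← lintegral_indicator (hΦ (hrm hU))]
  refine lintegral_congr_ae ?_
  filter_upwards [(hadm ν).2] with u hu
  have hu' := hu
  rw [← hpvv] at hu'
  have e3 : D.law ν (pv ν u) = D.law ν (D.ext (Φ u)) := by
    simp only [law, hpvv]
  by_cases hU' : K.restrict (Φ u) ∈ U
  · rw [Set.indicator_of_mem (by exact hU')]
    simp only [hU', true_and, Set.ofPred_mem_eq]
    rw [hfl ν _ hu', e3, ← hfl ν _ hu]
    rfl
  · rw [Set.indicator_of_notMem (by exact hU')]
    simp [hU']

open Classical in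
/-- The probability measure on value assignments that a well-defined database defines (it exists by
`WellDefined.exists_isJointLaw`). -/
noncomputable def jointLaw : Measure D.Val := if h : ∃ P, D.IsJointLaw P then h.choose else 0

/-- The part of the database that concerns the random variables in `S` and their ancestors. -/
def ancestral (S : Set N) : Database L N where
  vars := {ν ∈ D.vars | ν ∈ S ∨ ∃ c ∈ S, D.Ancestor ν c}
  dist := D.dist

/-- Widths of the intervals that `delta_interval` atoms stand for. -/
abbrev Widths (N : Type u) := N → ℚ → ℝ

/-- The truth of a comparison atom when the random variables have the values `ω`, for delta
intervals with widths `ε`. -/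
def Holds (ε : Widths N) (ω : N → ℝ) : CAtom L N → Prop
  | .cmp p l r => L.cmp p (l.eval ω) (r.eval ω)
  | .delta ν w => ((D.space ν ω).Countable ∧ ω ν = w) ∨
      (¬ (D.space ν ω).Countable ∧ w - ε ν w ≤ ω ν ∧ ω ν ≤ w + ε ν w)

/-- The measurable comparison atoms over the database.  Measurability refers to the (completed)
joint law of the random variables in the atom and their ancestors. -/
def comparisons : Set (CAtom L N) :=
  {κ | (∀ ν ∈ κ.terms, ν ∈ D.vars) ∧ ∀ ε : Widths N,
    NullMeasurableSet {ω : (D.ancestral {ν | ν ∈ κ.terms}).Val |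
      D.Holds ε ((D.ancestral {ν | ν ∈ κ.terms}).ext ω) κ}
      (D.ancestral {ν | ν ∈ κ.terms}).jointLaw}

/-- The consistent comparisons database of a value assignment. -/
def consistent (ε : Widths N) (ω : D.Val) : Set (CAtom L N) :=
  {κ ∈ D.comparisons | D.Holds ε (D.ext ω) κ}

end Database

/-! ## DF-PLP programs -/

/-- A DF-PLP program: a distributional database and ground normal clauses. -/
structure DFProgram (L : Vocabulary) (N : Type u) (H : Type v) where
  db : Database L N
  rules : Set (Clause L N H)

namespace DFProgram

variable (P : DFProgram L N H)

/-- The normal logic program consisting of the consistent comparisons database of `ω` and the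
clauses of the program. -/
def logicProgram (ε : Database.Widths N) (ω : P.db.Val) : Set (Rule (GAtom L N H)) :=
  {r | ∃ κ ∈ P.db.consistent ε ω, r = ⟨.cmp κ, []⟩} ∪
    {r | ∃ c ∈ P.rules, r = ⟨.reg c.head, c.body⟩}

/-- The Herbrand interpretation determined by a value assignment. -/
def model (ε : Database.Widths N) (ω : P.db.Val) : Set (GAtom L N H) :=
  (Rule.wellFoundedModel (P.logicProgram ε ω)).1

structure Valid (ε : Database.Widths N) : Prop where
  wellDefined : P.db.WellDefined
  comparisons : ∀ c ∈ P.rules, ∀ l ∈ c.body, ∀ κ, l.atom = .cmp κ → κ ∈ P.db.comparisons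
  twoValued : ∀ ω, P.db.Admissible ω → Rule.TwoValued (P.logicProgram ε ω)

/-- The value assignments under which the atom `μ` has the truth value `q`. -/
def queryEvent (ε : Database.Widths N) (μ : GAtom L N H) (q : Bool) : Set P.db.Val :=
  {ω | μ ∈ P.model ε ω ↔ q = true}

/-- The value assignments under which all `η ∈ E` have the truth value `e η`. -/
def evidenceEvent (ε : Database.Widths N) (E : Finset (GAtom L N H)) (e : GAtom L N H → Bool) :
    Set P.db.Val :=
  {ω | ∀ η ∈ E, (η ∈ P.model ε ω ↔ e η = true)}

/-- The probability of `E = e`. -/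
noncomputable def evidenceProb (ε : Database.Widths N) (E : Finset (GAtom L N H))
    (e : GAtom L N H → Bool) : ℝ :=
  P.db.jointLaw.real (P.evidenceEvent ε E e)

/-- The conditional probability of `μ = q` given `E = e`, for evidence of positive probability. -/
noncomputable def condProb (ε : Database.Widths N) (μ : GAtom L N H) (q : Bool)
    (E : Finset (GAtom L N H)) (e : GAtom L N H → Bool) : ℝ :=
  P.db.jointLaw.real (P.queryEvent ε μ q ∩ P.evidenceEvent ε E e) / P.evidenceProb ε E e

/-- `p` is the conditional probability of `μ = q` given `E = e`, for evidence which may be a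
zero-probability event: the limit of the conditional probabilities as the widths of the delta
intervals shrink to `0` along `l`. -/
structure IsLimitCondProb (l : Filter (Database.Widths N)) (μ : GAtom L N H) (q : Bool)
    (E : Finset (GAtom L N H)) (e : GAtom L N H → Bool) (p : ℝ) : Prop where
  neBot : l.NeBot
  shrink : ∀ ν w, Tendsto (fun ε : Database.Widths N => ε ν w) l (𝓝[>] 0)
  possible : ∀ᶠ ε in l, P.evidenceProb ε E e ≠ 0
  tendsto : Tendsto (fun ε => P.condProb ε μ q E e) l (𝓝 p)

/-- The atoms met in backward chaining from `S`. -/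
inductive Relevant (S : Set (GAtom L N H)) : GAtom L N H → Prop
  | start {a : GAtom L N H} : a ∈ S → Relevant S a
  | step {c : Clause L N H} {l : Lit (GAtom L N H)} :
      Relevant S (.reg c.head) → c ∈ P.rules → l ∈ c.body → Relevant S l.atom

/-- The relevant ground program with respect to the atoms in `S`: the clauses met in backward
chaining from `S`, and the distributional facts for the random variables in relevant comparison
atoms and for their ancestors. -/
def relevant (S : Set (GAtom L N H)) : DFProgram L N H where
  db := P.db.ancestral {ν | ∃ κ, P.Relevant S (.cmp κ) ∧ ν ∈ κ.terms}
  rules := {c ∈ P.rules | P.Relevant S (.reg c.head)}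

end DFProgram

/-! ## Propositional formulas -/

/-- Propositional formulas. -/
inductive Formula (α : Type v) : Type v
  | tru : Formula α
  | fls : Formula α
  | var (a : α) : Formula α
  | neg (φ : Formula α) : Formula α
  | and (φ ψ : Formula α) : Formula α
  | or (φ ψ : Formula α) : Formula α

namespace Formula

variable {α : Type*} {ι : Type*}

def imp (φ ψ : Formula α) : Formula α := or (neg φ) ψ

def iff (φ ψ : Formula α) : Formula α := and (imp φ ψ) (imp ψ φ)

def conj (l : List (Formula α)) : Formula α := l.foldr and tru

def disj (l : List (Formula α)) : Formula α := l.foldr or fls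

/-- The conjunction of `f i` over a finite set. -/
noncomputable def bigAnd (s : Finset ι) (f : ι → Formula α) : Formula α := conj (s.toList.map f)

/-- The disjunction of `f i` over a finite set. -/
noncomputable def bigOr (s : Finset ι) (f : ι → Formula α) : Formula α := disj (s.toList.map f)

def lit (l : Lit α) : Formula α := if l.sign then var l.atom else neg (var l.atom)

def Sat (M : Set α) : Formula α → Prop
  | tru => True
  | fls => False
  | var a => a ∈ M
  | neg φ => ¬ φ.Sat M
  | and φ ψ => φ.Sat M ∧ ψ.Sat M
  | or φ ψ => φ.Sat M ∨ ψ.Sat M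

open Classical in
noncomputable def vars : Formula α → Finset α
  | tru => ∅
  | fls => ∅
  | var a => {a}
  | neg φ => φ.vars
  | and φ ψ => φ.vars ∪ ψ.vars
  | or φ ψ => φ.vars ∪ ψ.vars

open Classical in
/-- The models of a formula: the truth assignments to its variables that satisfy it, each given as
the set of variables that it makes true. -/
noncomputable def models (φ : Formula α) : Finset (Finset α) :=
  φ.vars.powerset.filter fun M => φ.Sat M

end Formula

/-! ## The propositional formula of a finite ground program -/

namespace Clause

/-- The conjunction of the body literals. -/
def bodyFormula (c : Clause L N H) : Formula (GAtom L N H) := .conj (List.map .lit c.body)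

open Classical in
/-- All atoms in the finite program `R` and in `S`. -/
noncomputable def allAtoms (R : Finset (Clause L N H)) (S : Finset (GAtom L N H)) :
    Finset (GAtom L N H) :=
  S ∪ R.biUnion fun c => insert (.reg c.head) (List.map Lit.atom c.body).toFinset

open Classical in
/-- Clark's completion of one atom: a non-comparison atom is equivalent to the disjunction of the
bodies of its clauses. -/
noncomputable def completion (R : Finset (Clause L N H)) : GAtom L N H → Formula (GAtom L N H)
  | .reg h => .iff (.var (.reg h)) (.bigOr (R.filter fun c => c.head = h) bodyFormula)
  | .cmp _ => .tru

/-- `h` depends positively on `b` in one step. -/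
def PosDep (R : Finset (Clause L N H)) (h b : H) : Prop :=
  ∃ c ∈ R, c.head = h ∧ ∃ l ∈ c.body, l.sign = true ∧ l.atom = .reg b

/-- Loops: non-empty sets of atoms, any two of which are joined inside the set by a path of positive
length in the positive dependency graph. -/
def IsLoop (R : Finset (Clause L N H)) (K : Finset H) : Prop :=
  K.Nonempty ∧ ∀ a ∈ K, ∀ b ∈ K,
    Relation.TransGen (fun x y => x ∈ K ∧ y ∈ K ∧ PosDep R x y) a b

open Classical in
noncomputable def loops (R : Finset (Clause L N H)) : Finset (Finset H) :=
  (R.image Clause.head).powerset.filter fun K => IsLoop R K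

open Classical in
/-- The loop formula of `K`: if some atom of `K` is true, then so is the body of some clause for an
atom of `K` that does not use atoms of `K` positively. -/
noncomputable def loopFormula (R : Finset (Clause L N H)) (K : Finset H) :
    Formula (GAtom L N H) :=
  .imp (.bigOr K fun h => .var (.reg h))
    (.bigOr (R.filter fun c => c.head ∈ K ∧
      ∀ l ∈ c.body, l.sign = true → ∀ h ∈ K, l.atom ≠ .reg h) bodyFormula)

/-- The propositional formula of a finite ground program: Clark's completion, conjoined with the
loop formulas for the cycles through positive literals (there are none in acyclic programs). -/
noncomputable def encoding (R : Finset (Clause L N H)) (S : Finset (GAtom L N H)) :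
    Formula (GAtom L N H) :=
  .and (.bigAnd (allAtoms R S) (completion R)) (.bigAnd (loops R) (loopFormula R))

end Clause

/-- The conjunction of literals that asserts `E = e`. -/
noncomputable def evidenceFormula (E : Finset (GAtom L N H)) (e : GAtom L N H → Bool) :
    Formula (GAtom L N H) :=
  .bigAnd E fun η => .lit ⟨η, e η⟩

namespace DFProgram

variable (P : DFProgram L N H)

/-- The relevant ground program with respect to the queries `Q` and the evidence atoms `E`. -/
def relevantTo (Q E : Finset (GAtom L N H)) : DFProgram L N H := P.relevant (↑Q ∪ ↑E)

open Classical in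
/-- The formula that encodes the (finite) relevant ground program, with the evidence asserted. -/
noncomputable def formula (Q E : Finset (GAtom L N H)) (e : GAtom L N H → Bool)
    (hfin : (P.relevantTo Q E).rules.Finite) : Formula (GAtom L N H) :=
  .and (Clause.encoding hfin.toFinset (Q ∪ E)) (evidenceFormula E e)

end DFProgram

/-! ## Labels -/

namespace Database

variable (D : Database L N)

open Classical in
/-- The label of a literal: an Iverson bracket for comparison atoms, `1` for all other atoms. -/
noncomputable def litLabel (ε : Widths N) (ω : N → ℝ) : Lit (GAtom L N H) → ℝ
  | ⟨.cmp κ, true⟩ => if D.Holds ε ω κ then 1 else 0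
  | ⟨.cmp κ, false⟩ => if ¬ D.Holds ε ω κ then 1 else 0
  | ⟨.reg _, _⟩ => 1

open Classical in
/-- The label of a formula: the sum over its models of the products of the labels of their
literals. -/
noncomputable def label (ε : Widths N) (ω : N → ℝ) (φ : Formula (GAtom L N H)) : ℝ :=
  ∑ M ∈ φ.models, ∏ a ∈ φ.vars, D.litLabel ε ω ⟨a, decide (a ∈ M)⟩

/-- The label of a formula as a function of the values of the random variables. -/
noncomputable def labelVar (ε : Widths N) (φ : Formula (GAtom L N H)) : D.Val → ℝ :=
  fun ω => D.label ε (D.ext ω) φ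

/-- The expected label of a formula. -/
noncomputable def expectedLabel (ε : Widths N) (φ : Formula (GAtom L N H)) : ℝ :=
  ∫ ω, D.labelVar ε φ ω ∂D.jointLaw

end Database

/-! ## AD-free DC-ProbLog programs -/

/-- Distributional clauses `head ∼ dist ← body`. -/
structure DClause (L : Vocabulary) (T : Type u) (A : Type v) where
  head : T
  dist : DistTerm L T
  body : Body L T A

/-- AD-free programs: distributional clauses (distributional facts being those with an empty body)
and normal clauses, over ground terms `T` and regular ground atoms `A`. -/
structure ADFree (L : Vocabulary) (T : Type u) (A : Type v) where
  dcs : Set (DClause L T A)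
  rules : Set (Clause L T A)

/-- Names for the random variables that distributional clauses give rise to: one for each clause `c`
and each choice of random variables `σ` for the random terms in its distribution term. -/
inductive RVar (L : Vocabulary) (T : Type u) (A : Type v) : Type (max u v)
  | mk (c : DClause L T A) (σ : {ρ // ρ ∈ c.dist.terms} → RVar L T A) : RVar L T A

open Classical in
/-- The distribution term of a random variable: the one of its clause, with each random term
replaced by the chosen random variable (the `else` branch is never used). -/
noncomputable def RVar.dist : RVar L T A → DistTerm L (RVar L T A)
  | .mk c σ => c.dist.map fun ρ => if h : ρ ∈ c.dist.terms then σ ⟨ρ, h⟩ else .mk c σ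

/-- Non-comparison atoms of the DF-PLP program: regular atoms and `rv(τ, ν)`. -/
inductive HAtom (L : Vocabulary) (T : Type u) (A : Type v) : Type (max u v)
  | base (a : A) : HAtom L T A
  | rv (τ : T) (ν : RVar L T A) : HAtom L T A

/-- The ground atoms of the DF-PLP program that an AD-free program stands for. -/
abbrev DFAtom (L : Vocabulary) (T : Type u) (A : Type v) := GAtom L (RVar L T A) (HAtom L T A)

namespace ADFree

variable (P : ADFree L T A)

/-- The random terms. -/
def randomTerms : Set T := {τ | ∃ c ∈ P.dcs, c.head = τ}

def Parent (p c : T) : Prop := p ∈ P.randomTerms ∧ ∃ d ∈ P.dcs, d.head = c ∧ p ∈ d.dist.terms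

def Ancestor : T → T → Prop := Relation.TransGen P.Parent

/-- `P.IsVar τ ν`: the random variable `ν` belongs to the random term `τ`. -/
inductive IsVar : T → RVar L T A → Prop
  | mk (c : DClause L T A) (σ : {ρ // ρ ∈ c.dist.terms} → RVar L T A) :
      c ∈ P.dcs → (∀ ρ, IsVar ρ.1 (σ ρ)) → IsVar c.head (.mk c σ)

/-- The distributional facts that encode the distributional clauses. -/
noncomputable def db : Database L (RVar L T A) where
  vars := {ν | ∃ τ, P.IsVar τ ν}
  dist := RVar.dist

/-- The contextualized body: interpreted occurrences of the random terms are replaced by random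
variables according to `θ`, and the atoms `rv(τ, θ τ)` are conjoined. -/
def contextualize (θ : T → RVar L T A) (β : Body L T A) :
    Body L (RVar L T A) (HAtom L T A) :=
  β.terms.map (fun τ => ⟨.reg (.rv τ (θ τ)), true⟩) ++
    β.rename θ .base

/-- `θ` is an instantiation of the random terms interpreted by `β`. -/
def Instantiates (θ : T → RVar L T A) (β : Body L T A) : Prop := ∀ τ ∈ β.terms, P.IsVar τ (θ τ)

/-- The contextualized context clauses. -/
def contextRules : Set (Clause L (RVar L T A) (HAtom L T A)) :=
  {r | ∃ (c : DClause L T A) (σ : {ρ // ρ ∈ c.dist.terms} → RVar L T A) (θ : T → RVar L T A),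
    c ∈ P.dcs ∧ (∀ ρ, P.IsVar ρ.1 (σ ρ)) ∧ P.Instantiates θ c.body ∧
    r = ⟨.rv c.head (.mk c σ),
      c.dist.terms.attach.map (fun ρ => ⟨.reg (.rv ρ.1 (σ ρ)), true⟩) ++ contextualize θ c.body⟩}

/-- The contextualized normal clauses. -/
def logicRules : Set (Clause L (RVar L T A) (HAtom L T A)) :=
  {r | ∃ c ∈ P.rules, ∃ θ : T → RVar L T A, P.Instantiates θ c.body ∧
    r = ⟨.base c.head, contextualize θ c.body⟩}

/-- The DF-PLP program that gives the AD-free program its meaning. -/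
noncomputable def toDF : DFProgram L (RVar L T A) (HAtom L T A) where
  db := P.db
  rules := P.contextRules ∪ P.logicRules

/-- The body `β` is true in the interpretation `M` of the DF-PLP program. -/
def BodyTrue (M : Set (DFAtom L T A)) (β : Body L T A) : Prop :=
  ∃ θ, P.Instantiates θ β ∧ ∀ l ∈ contextualize θ β, (l.atom ∈ M ↔ l.sign = true)

/-- Well-defined sets of distributional clauses.  (That distribution terms are well-defined for all
values of the random terms they interpret is part of the well-definedness of the distributional
database `P.db`.) -/
structure WellDefined (ε : Database.Widths (RVar L T A)) : Prop where
  finite_clauses : ∀ τ, {c ∈ P.dcs | c.head = τ}.Finite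
  exclusive : ∀ c ∈ P.dcs, ∀ c' ∈ P.dcs, c ≠ c' → c.head = c'.head →
    ∀ ω, P.db.Admissible ω →
      ¬ (P.BodyTrue (P.toDF.model ε ω) c.body ∧ P.BodyTrue (P.toDF.model ε ω) c'.body)
  finite_ancestors : ∀ τ ∈ P.randomTerms, {a | P.Ancestor a τ}.Finite
  acyclic : ∀ τ ∈ P.randomTerms, ¬ P.Ancestor τ τ

/-- Valid AD-free programs. -/
def Valid (ε : Database.Widths (RVar L T A)) : Prop := P.WellDefined ε ∧ P.toDF.Valid ε

end ADFree

/-! ## DC-ProbLog programs -/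

/-- DC-ProbLog statements: probabilistic facts `p :: μ`, annotated disjunctions
`p₁ :: μ₁; …; pₙ :: μₙ ← β`, distributional clauses and normal clauses. -/
inductive Stmt (L : Vocabulary) (T : Type u) (A : Type v) : Type (max u v)
  | pfact (p : AExpr L T) (μ : A) : Stmt L T A
  | ad (n : ℕ) (p : Fin n → AExpr L T) (μ : Fin n → A) (β : Body L T A) : Stmt L T A
  | dc (c : DClause L T A) : Stmt L T A
  | rule (c : Clause L T A) : Stmt L T A

/-- Terms of the AD-free program: the original ones, and one fresh term for each statement. -/
inductive FTerm (L : Vocabulary) (T : Type u) (A : Type v) : Type (max u v)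
  | base (t : T) : FTerm L T A
  | fresh (s : Stmt L T A) : FTerm L T A

namespace Stmt

/-- The distributional clauses that replace a statement. -/
def dcs : Stmt L T A → Set (DClause L (FTerm L T A) A)
  | .pfact p μ => {⟨.fresh (.pfact p μ), ⟨L.flip, 1, fun _ => p.map .base⟩, []⟩}
  | .ad n p μ β => {⟨.fresh (.ad n p μ β), ⟨L.finite, n, fun i => (p i).map .base⟩, []⟩}
  | .dc c => {⟨.base c.head, c.dist.map .base, c.body.rename .base id⟩}
  | .rule _ => ∅

/-- The comparison `ν =:= k` with the fresh term `ν` of the statement `s`. -/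
def freshIs (s : Stmt L T A) (k : ℕ) : Lit (GAtom L (FTerm L T A) A) :=
  ⟨.cmp (.cmp L.eqv (.term (.fresh s)) (.num k)), true⟩

/-- The normal clauses that replace a statement. -/
def rules : Stmt L T A → Set (Clause L (FTerm L T A) A)
  | .pfact p μ => {⟨μ, [freshIs (.pfact p μ) 1]⟩}
  | .ad n p μ β =>
      Set.range fun i : Fin n => ⟨μ i, freshIs (.ad n p μ β) (i + 1) :: β.rename .base id⟩
  | .dc _ => ∅
  | .rule c => {⟨c.head, c.body.rename .base id⟩}

end Stmt

/-- A DC-ProbLog program: a countable set of ground statements. -/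
structure Program (L : Vocabulary) (T : Type u) (A : Type v) where
  stmts : Set (Stmt L T A)
  countable : stmts.Countable

namespace Program

variable (P : Program L T A)

/-- Elimination of probabilistic facts and annotated disjunctions. -/
def toADFree : ADFree L (FTerm L T A) A where
  dcs := ⋃ s ∈ P.stmts, s.dcs
  rules := ⋃ s ∈ P.stmts, s.rules

/-- The DF-PLP program that gives the program its meaning. -/
noncomputable def toDF :
    DFProgram L (RVar L (FTerm L T A) A) (HAtom L (FTerm L T A) A) := P.toADFree.toDF

/-- Valid DC-ProbLog programs. -/
def Valid (ε : Database.Widths (RVar L (FTerm L T A) A)) : Prop := P.toADFree.Valid ε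

end Program

end DCProbLog

open DCProbLog

/-! Fix an admissible `ω`. It decides every comparison atom, and the label of a formula counts those
models of the formula whose comparison literals are right under `ω`. For a formula that entails the
encoding of the relevant ground program this count is `0` or `1`. Indeed the well-founded model
satisfies the encoding (`sat_encoding_model`), and every model of the encoding with the same
comparison atoms agrees with it on all relevant atoms (`mem_iff_of_sat_encoding`). So the label is
the indicator that the well-founded model satisfies the formula (`label_eq_ite`). For `φ` this is
the indicator of the evidence, for `φ ∧ φ_q` that of evidence and query, and taking expectations
gives numerator and denominator.

The agreement is where the loop formulas enter. Let `M` be a model of the encoding. It induces a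
pre-fixed point of the well-founded operator, which therefore lies above the least fixed point;
two-valuedness turns this inequality into agreement. The point to check is that no relevant atom
true in `M` is unfounded. Otherwise each such atom would depend positively on a member of a finite
set of such atoms. That set contains a strongly connected piece with no edges to the rest of the set
(`exists_terminal_loop`), and its loop formula asks for a clause that cannot exist.

The rest is measure theory. Labels live on the relevant random variables, the conditional
probability on all of them. The joint law is merely some measure that obeys the chain rule, so it is
shown to be unique (`IsJointLaw.unique`); hence its marginal on a parent-closed part is the joint
law of that part (`IsClosedPart.map_jointLaw`). Almost every `ω` is admissible (`ae_admissible`), so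
the pointwise identity of labels and indicators can be integrated (`Valid.expectedLabel_eq`). The
statement on zero-probability evidence follows because the quotients agree eventually along the
filter. -/

open scoped ProbabilityTheory

namespace DCProbLog

universe u v

/-! ### Satisfaction and variables of propositional formulas -/

namespace Formula

variable {α ι : Type*} {M M' : Set α}

theorem sat_conj {l : List (Formula α)} : (conj l).Sat M ↔ ∀ φ ∈ l, φ.Sat M := by
  induction l with
  | nil => simp [conj, Sat]
  | cons φ l ih =>
    have : (conj (φ :: l)).Sat M ↔ φ.Sat M ∧ (conj l).Sat M := Iff.rfl
    rw [this, ih]; simp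

theorem sat_disj {l : List (Formula α)} : (disj l).Sat M ↔ ∃ φ ∈ l, φ.Sat M := by
  induction l with
  | nil => simp [disj, Sat]
  | cons φ l ih =>
    have : (disj (φ :: l)).Sat M ↔ φ.Sat M ∨ (disj l).Sat M := Iff.rfl
    rw [this, ih]; simp

theorem sat_bigAnd {s : Finset ι} {f : ι → Formula α} :
    (bigAnd s f).Sat M ↔ ∀ i ∈ s, (f i).Sat M := by
  simp [bigAnd, sat_conj]

theorem sat_bigOr {s : Finset ι} {f : ι → Formula α} :
    (bigOr s f).Sat M ↔ ∃ i ∈ s, (f i).Sat M := by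
  simp [bigOr, sat_disj]

theorem sat_imp {φ ψ : Formula α} : (imp φ ψ).Sat M ↔ (φ.Sat M → ψ.Sat M) := by
  simp only [imp, Sat]; tauto

theorem sat_iff {φ ψ : Formula α} : (iff φ ψ).Sat M ↔ (φ.Sat M ↔ ψ.Sat M) := by
  simp only [iff, Sat, sat_imp]; tauto

theorem sat_lit {l : Lit α} : (lit l).Sat M ↔ (l.atom ∈ M ↔ l.sign = true) := by
  obtain ⟨a, s⟩ := l
  cases s <;> simp [lit, Sat]

theorem sat_congr {φ : Formula α} (h : ∀ a ∈ φ.vars, a ∈ M ↔ a ∈ M') :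
    φ.Sat M ↔ φ.Sat M' := by
  classical
  induction φ with
  | tru => rfl
  | fls => rfl
  | var a => exact h a (by simp [vars])
  | neg φ ih => exact not_congr (ih h)
  | and φ ψ ih₁ ih₂ =>
    exact and_congr (ih₁ fun a ha => h a (by simp [vars, ha]))
      (ih₂ fun a ha => h a (by simp [vars, ha]))
  | or φ ψ ih₁ ih₂ =>
    exact or_congr (ih₁ fun a ha => h a (by simp [vars, ha]))
      (ih₂ fun a ha => h a (by simp [vars, ha]))

theorem mem_vars_conj {l : List (Formula α)} {a : α} :
    a ∈ (conj l).vars ↔ ∃ φ ∈ l, a ∈ φ.vars := by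
  classical
  induction l with
  | nil => simp [conj, vars]
  | cons φ l ih =>
    have : a ∈ (conj (φ :: l)).vars ↔ a ∈ φ.vars ∨ a ∈ (conj l).vars := by
      simp [conj, vars]
    rw [this, ih]; simp

theorem mem_vars_disj {l : List (Formula α)} {a : α} :
    a ∈ (disj l).vars ↔ ∃ φ ∈ l, a ∈ φ.vars := by
  classical
  induction l with
  | nil => simp [disj, vars]
  | cons φ l ih =>
    have : a ∈ (disj (φ :: l)).vars ↔ a ∈ φ.vars ∨ a ∈ (disj l).vars := by
      simp [disj, vars]
    rw [this, ih]; simp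

theorem mem_vars_bigAnd {s : Finset ι} {f : ι → Formula α} {a : α} :
    a ∈ (bigAnd s f).vars ↔ ∃ i ∈ s, a ∈ (f i).vars := by
  simp [bigAnd, mem_vars_conj]

theorem mem_vars_bigOr {s : Finset ι} {f : ι → Formula α} {a : α} :
    a ∈ (bigOr s f).vars ↔ ∃ i ∈ s, a ∈ (f i).vars := by
  simp [bigOr, mem_vars_disj]

theorem mem_vars_lit {l : Lit α} {a : α} : a ∈ (lit l).vars ↔ a = l.atom := by
  obtain ⟨b, s⟩ := l
  cases s <;> simp [lit, vars]

theorem mem_vars_and {φ ψ : Formula α} {a : α} :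
    a ∈ (Formula.and φ ψ).vars ↔ a ∈ φ.vars ∨ a ∈ ψ.vars := by
  simp [vars]

theorem mem_vars_imp {φ ψ : Formula α} {a : α} :
    a ∈ (imp φ ψ).vars ↔ a ∈ φ.vars ∨ a ∈ ψ.vars := by
  simp [imp, vars]

theorem mem_vars_iff {φ ψ : Formula α} {a : α} :
    a ∈ (iff φ ψ).vars ↔ a ∈ φ.vars ∨ a ∈ ψ.vars := by
  simp only [iff, mem_vars_and, mem_vars_imp]; tauto

end Formula

variable {L : Vocabulary} {N : Type u} {H : Type v}

/-! ### The encoding of a finite program, read semantically -/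

namespace Clause

/-- The body of a clause is true in an interpretation. -/
def BodyHolds (M : Set (GAtom L N H)) (c : Clause L N H) : Prop :=
  ∀ l ∈ c.body, (l.atom ∈ M ↔ l.sign = true)

/-- The clause uses no atom of `K` positively. -/
def External (K : Set H) (c : Clause L N H) : Prop :=
  ∀ l ∈ c.body, l.sign = true → ∀ h ∈ K, l.atom ≠ .reg h

theorem sat_bodyFormula {M : Set (GAtom L N H)} {c : Clause L N H} :
    c.bodyFormula.Sat M ↔ c.BodyHolds M := by
  simp [bodyFormula, Formula.sat_conj, Formula.sat_lit, BodyHolds]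

theorem mem_vars_bodyFormula {c : Clause L N H} {a : GAtom L N H} :
    a ∈ c.bodyFormula.vars ↔ ∃ l ∈ c.body, l.atom = a := by
  simp [bodyFormula, Formula.mem_vars_conj, Formula.mem_vars_lit, eq_comm]

theorem mem_allAtoms {R : Finset (Clause L N H)} {S : Finset (GAtom L N H)} {a : GAtom L N H} :
    a ∈ allAtoms R S ↔ a ∈ S ∨ ∃ c ∈ R, a = .reg c.head ∨ ∃ l ∈ c.body, l.atom = a := by
  simp [allAtoms]

open Classical in
-- The two conditions, supportedness of each atom and external support of each loop that meets `M`,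
-- are the form in which the encoding is used from here on.
theorem sat_encoding {R : Finset (Clause L N H)} {S : Finset (GAtom L N H)}
    {M : Set (GAtom L N H)} :
    (encoding R S).Sat M ↔
      (∀ h, .reg h ∈ allAtoms R S → (.reg h ∈ M ↔ ∃ c ∈ R, c.head = h ∧ c.BodyHolds M)) ∧
      ∀ K : Finset H, K ⊆ R.image Clause.head → IsLoop R K →
        (∃ h ∈ K, .reg h ∈ M) → ∃ c ∈ R, c.head ∈ K ∧ c.External ↑K ∧ c.BodyHolds M := by
  refine and_congr ?_ ?_
  · rw [Formula.sat_bigAnd]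
    constructor
    · intro h a ha
      have := h _ ha
      simpa only [completion, Formula.sat_iff, Formula.sat_bigOr, Finset.mem_filter,
        sat_bodyFormula, and_assoc, Formula.Sat] using this
    · rintro h (a | κ) ha
      · simpa only [completion, Formula.sat_iff, Formula.sat_bigOr, Finset.mem_filter,
          sat_bodyFormula, and_assoc, Formula.Sat] using h a ha
      · trivial
  · rw [Formula.sat_bigAnd]
    simp only [loops, Finset.mem_filter, Finset.mem_powerset, loopFormula, Formula.sat_imp,
      Formula.sat_bigOr, sat_bodyFormula, and_assoc, Formula.Sat, External, and_imp, Finset.mem_coe]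

/-- Loops consist of heads of clauses, so the loop formulas bring in no atoms beyond those of the
program. -/
theorem vars_encoding_subset {R : Finset (Clause L N H)} {S : Finset (GAtom L N H)} :
    (encoding R S).vars ⊆ allAtoms R S := by
  classical
  intro a ha
  have hbody : ∀ c ∈ R, a ∈ c.bodyFormula.vars → a ∈ allAtoms R S := fun c hc h =>
    mem_allAtoms.2 (.inr ⟨c, hc, .inr (mem_vars_bodyFormula.1 h)⟩)
  rw [encoding, Formula.mem_vars_and, Formula.mem_vars_bigAnd, Formula.mem_vars_bigAnd] at ha
  rcases ha with ⟨b, hb, ha⟩ | ⟨K, hK, ha⟩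
  · rcases b with h | κ
    · rw [completion, Formula.mem_vars_iff, Formula.mem_vars_bigOr] at ha
      rcases ha with ha | ⟨c, hc, ha⟩
      · simp only [Formula.vars, Finset.mem_singleton] at ha
        rwa [ha]
      · exact hbody c (Finset.mem_filter.1 hc).1 ha
    · simp [completion, Formula.vars] at ha
  · rw [loopFormula, Formula.mem_vars_imp, Formula.mem_vars_bigOr, Formula.mem_vars_bigOr] at ha
    rcases ha with ⟨h, hh, ha⟩ | ⟨c, hc, ha⟩
    · simp only [Formula.vars, Finset.mem_singleton] at ha
      obtain ⟨c, hc, rfl⟩ := Finset.mem_image.1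
        (Finset.mem_powerset.1 (Finset.mem_filter.1 hK).1 hh)
      exact mem_allAtoms.2 (.inr ⟨c, hc, .inl ha⟩)
    · exact hbody c (Finset.mem_filter.1 hc).1 ha

end Clause

theorem sat_evidenceFormula {E : Finset (GAtom L N H)} {e : GAtom L N H → Bool}
    {M : Set (GAtom L N H)} :
    (evidenceFormula E e).Sat M ↔ ∀ η ∈ E, (η ∈ M ↔ e η = true) := by
  simp [evidenceFormula, Formula.sat_bigAnd, Formula.sat_lit]

/-! ### Labels of formulas with at most one relevant model -/

namespace Database

variable (D : Database L N)

open Classical in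
-- Regular literals have label `1` and comparison literals `0` or `1`, so the product only tests
-- whether `M` is right about the comparison atoms in `V`.
theorem prod_litLabel (ε : Widths N) (ω : N → ℝ) (V M : Finset (GAtom L N H)) :
    ∏ a ∈ V, D.litLabel ε ω ⟨a, decide (a ∈ M)⟩ =
      if ∀ κ, .cmp κ ∈ V → (.cmp κ ∈ M ↔ D.Holds ε ω κ) then 1 else 0 := by
  split_ifs with h
  · refine Finset.prod_eq_one fun a ha => ?_
    rcases a with a | κ
    · by_cases hM : GAtom.reg a ∈ M <;> simp [litLabel]
    · have := h κ ha
      by_cases hM : GAtom.cmp κ ∈ M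
      · simp [litLabel, hM, this.1 hM]
      · simp [litLabel, hM, mt this.2 hM]
  · push Not at h
    obtain ⟨κ, hκ, h⟩ := h
    refine Finset.prod_eq_zero hκ ?_
    by_cases hM : GAtom.cmp κ ∈ M
    · have : ¬ D.Holds ε ω κ := by tauto
      simp [litLabel, hM, this]
    · have : D.Holds ε ω κ := by tauto
      simp [litLabel, hM, this]

open Classical in
-- By `huniq`, at most one model of `φ` has the comparison atoms of `W`, namely the trace of `W` on
-- the variables of `φ`. All other models have label `0`, so the sum has at most one nonzero term.
theorem label_eq_ite {ε : Widths N} {ω : N → ℝ} {φ : Formula (GAtom L N H)}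
    {W : Set (GAtom L N H)}
    (hW : ∀ κ, .cmp κ ∈ φ.vars → (.cmp κ ∈ W ↔ D.Holds ε ω κ))
    (huniq : ∀ M : Set (GAtom L N H), φ.Sat M → (∀ κ, .cmp κ ∈ M ↔ .cmp κ ∈ W) →
      ∀ a ∈ φ.vars, a ∈ M ↔ a ∈ W) :
    D.label ε ω φ = if φ.Sat W then 1 else 0 := by
  have key : ∀ M ∈ φ.models, (∀ κ, .cmp κ ∈ φ.vars → (.cmp κ ∈ M ↔ D.Holds ε ω κ)) →
      M = φ.vars.filter (· ∈ W) := by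
    intro M hM hc
    obtain ⟨hMv, hMs⟩ := Finset.mem_filter.1 hM
    rw [Finset.mem_powerset] at hMv
    -- `M` knows only the variables of `φ`, while `huniq` asks for agreement with `W` on all
    -- comparison atoms. So the comparison atoms are taken from `W`; on the variables of `φ` this
    -- changes nothing.
    let M' : Set (GAtom L N H) := {a | match a with
      | .reg h => .reg h ∈ M
      | .cmp κ => .cmp κ ∈ W}
    have hMM' : ∀ a ∈ φ.vars, a ∈ M' ↔ a ∈ (M : Set (GAtom L N H)) := by
      rintro (h | κ) ha
      · rfl
      · exact (hW κ ha).trans (hc κ ha).symm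
    have := huniq M' ((Formula.sat_congr hMM').2 hMs) fun κ => Iff.rfl
    ext a
    rw [Finset.mem_filter]
    constructor
    · intro ha
      exact ⟨hMv ha, (this a (hMv ha)).1 ((hMM' a (hMv ha)).2 ha)⟩
    · rintro ⟨ha, haW⟩
      exact (hMM' a ha).1 ((this a ha).2 haW)
  have hsat : φ.Sat ↑(φ.vars.filter (· ∈ W)) ↔ φ.Sat W :=
    Formula.sat_congr fun a ha => by simp [ha]
  simp only [label, prod_litLabel]
  split_ifs with h
  · rw [Finset.sum_eq_single (φ.vars.filter (· ∈ W))]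
    · rw [if_pos]
      intro κ hκ
      rw [← hW κ hκ]
      simp [hκ]
    · intro M hM hne
      exact if_neg fun hc => hne (key M hM hc)
    · intro hn
      refine absurd ?_ hn
      rw [Formula.models, Finset.mem_filter, Finset.mem_powerset]
      exact ⟨Finset.filter_subset _ _, hsat.2 h⟩
  · refine Finset.sum_eq_zero fun M hM => if_neg fun hc => h ?_
    have := (Finset.mem_filter.1 hM).2
    rw [key M hM hc] at this
    exact hsat.1 this

end Database

/-! ### Two-valued well-founded models -/

namespace DFProgram

variable (P : DFProgram L N H) {ε : Database.Widths N} {ω : P.db.Val}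

theorem consequences_wellFoundedModel {α : Type*} (R : Set (Rule α)) :
    Rule.consequences R (Rule.wellFoundedModel R) = (Rule.wellFoundedModel R).1 :=
  congrArg Prod.fst (Rule.wfOperator R).map_lfp

theorem greatestUnfounded_wellFoundedModel {α : Type*} (R : Set (Rule α)) :
    Rule.greatestUnfounded R (Rule.wellFoundedModel R) = (Rule.wellFoundedModel R).2 :=
  congrArg Prod.snd (Rule.wfOperator R).map_lfp

/-- The only rules with a comparison head are the facts of the consistent comparisons database. -/
theorem cmp_mem_model {κ : CAtom L N} :
    .cmp κ ∈ P.model ε ω ↔ κ ∈ P.db.consistent ε ω := by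
  rw [model, ← consequences_wellFoundedModel]
  constructor
  · rintro ⟨r, ⟨κ', hκ', rfl⟩ | ⟨c, hc, rfl⟩, hr, -⟩
    · cases hr; exact hκ'
    · cases hr
  · intro h
    exact ⟨_, .inl ⟨κ, h, rfl⟩, rfl, by simp⟩

variable {P}

theorem mem_wellFoundedModel_snd (h2 : Rule.TwoValued (P.logicProgram ε ω)) {a : GAtom L N H} :
    a ∈ (Rule.wellFoundedModel (P.logicProgram ε ω)).2 ↔ a ∉ P.model ε ω := by
  have : (Rule.wellFoundedModel (P.logicProgram ε ω)).2 = (P.model ε ω)ᶜ := h2.compl_eq.symm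
  rw [this]; rfl

theorem litTrue_wellFoundedModel (h2 : Rule.TwoValued (P.logicProgram ε ω))
    {l : Lit (GAtom L N H)} :
    Rule.litTrue (Rule.wellFoundedModel (P.logicProgram ε ω)) l ↔
      (l.atom ∈ P.model ε ω ↔ l.sign = true) := by
  rw [Rule.litTrue, mem_wellFoundedModel_snd h2]
  change _ ∧ l.atom ∈ P.model ε ω ∨ _ ↔ _
  cases l.sign <;> simp

theorem litFalse_wellFoundedModel (h2 : Rule.TwoValued (P.logicProgram ε ω))
    {l : Lit (GAtom L N H)} :
    Rule.litFalse (Rule.wellFoundedModel (P.logicProgram ε ω)) l ↔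
      ¬ (l.atom ∈ P.model ε ω ↔ l.sign = true) := by
  rw [Rule.litFalse, mem_wellFoundedModel_snd h2]
  change _ ∨ _ ∧ l.atom ∈ P.model ε ω ↔ _
  cases l.sign <;> simp

/-- When the model is two-valued, truth of literals in the partial interpretation is classical
truth, and the fixed-point equation for the true atoms becomes Clark's completion. -/
theorem reg_mem_model (h2 : Rule.TwoValued (P.logicProgram ε ω)) {h : H} :
    .reg h ∈ P.model ε ω ↔ ∃ c ∈ P.rules, c.head = h ∧ c.BodyHolds (P.model ε ω) := by
  conv_lhs => rw [model, ← consequences_wellFoundedModel]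
  constructor
  · rintro ⟨r, ⟨κ', hκ', rfl⟩ | ⟨c, hc, rfl⟩, hr, hb⟩
    · cases hr
    · cases hr
      exact ⟨c, hc, rfl, fun l hl => (litTrue_wellFoundedModel h2).1 (hb l hl)⟩
  · rintro ⟨c, hc, rfl, hb⟩
    exact ⟨_, .inr ⟨c, hc, rfl⟩, rfl, fun l hl => (litTrue_wellFoundedModel h2).2 (hb l hl)⟩

/-- Every set of atoms that meets the model has external support in it. -/
theorem exists_external_support (h2 : Rule.TwoValued (P.logicProgram ε ω)) {K : Set H} {h : H}
    (hK : h ∈ K) (hM : .reg h ∈ P.model ε ω) :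
    ∃ c ∈ P.rules, c.head ∈ K ∧ c.External K ∧ c.BodyHolds (P.model ε ω) := by
  by_contra! hno
  set I := Rule.wellFoundedModel (P.logicProgram ε ω) with hI
  -- Without external support for `K`, the true atoms of `K` together with the false atoms form an
  -- unfounded set. The false atoms are the greatest unfounded set, so `h` would be false.
  let U : Set (GAtom L N H) := I.2 ∪ {a | a ∈ P.model ε ω ∧ ∃ k ∈ K, a = .reg k}
  have hU : Rule.Unfounded (P.logicProgram ε ω) I U := by
    intro r hr hrU
    rcases hrU with hrU | ⟨hrM, k, hk, hrk⟩
    · rw [hI, ← greatestUnfounded_wellFoundedModel] at hrU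
      obtain ⟨V, hV, hrV⟩ := hrU
      refine (hV r hr hrV).imp id ?_
      rintro ⟨l, hl, hs, hlV⟩
      refine ⟨l, hl, hs, .inl ?_⟩
      rw [hI, ← greatestUnfounded_wellFoundedModel]
      exact ⟨V, hV, hlV⟩
    · rcases hr with ⟨κ, hκ, rfl⟩ | ⟨c, hc, rfl⟩
      · cases hrk
      · cases hrk
        by_cases hb : c.BodyHolds (P.model ε ω)
        · have : ¬ c.External K := fun h => hno c hc hk h hb
          simp only [Clause.External] at this
          push Not at this
          obtain ⟨l, hl, hs, k, hk, hlk⟩ := this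
          exact .inr ⟨l, hl, hs, .inr ⟨(hb l hl).2 hs, k, hk, hlk⟩⟩
        · simp only [Clause.BodyHolds, not_forall] at hb
          obtain ⟨l, hl, hb⟩ := hb
          exact .inl ⟨l, hl, (litFalse_wellFoundedModel h2).2 hb⟩
  have : GAtom.reg h ∈ I.2 := by
    rw [hI, ← greatestUnfounded_wellFoundedModel]
    exact ⟨U, hU, .inr ⟨hM, h, hK, rfl⟩⟩
  exact (mem_wellFoundedModel_snd h2).1 this hM

end DFProgram

/-! ### Loops -/

/-- In a finite set of atoms each of which depends on another one there is a loop without edges to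
the rest of the set. -/
theorem Clause.exists_terminal_loop {R : Finset (Clause L N H)} {U : Finset H} (hne : U.Nonempty)
    (hU : ∀ a ∈ U, ∃ b ∈ U, PosDep R a b) :
    ∃ K ⊆ U, IsLoop R K ∧ ∀ a ∈ K, ∀ b ∈ U, PosDep R a b → b ∈ K := by
  classical
  let r : H → H → Prop := fun x y => x ∈ U ∧ y ∈ U ∧ PosDep R x y
  let reach : H → Finset H := fun a => U.filter fun b => Relation.TransGen r a b
  have hmem : ∀ {a b}, b ∈ reach a ↔ Relation.TransGen r a b := by
    intro a b
    simp only [reach, Finset.mem_filter, and_iff_right_iff_imp]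
    intro h
    obtain ⟨c, -, h⟩ := Relation.TransGen.tail'_iff.1 h
    exact h.2.1
  -- Choosing `a` with the fewest reachable elements makes `reach` constant on `reach a`: every
  -- element reaches exactly `reach a`, so this set is strongly connected and no edge leads from it
  -- to the rest of `U`.
  obtain ⟨a, ha, hmin⟩ := U.exists_min_image (fun a => (reach a).card) hne
  have heq : ∀ b ∈ reach a, reach b = reach a := by
    intro b hb
    refine Finset.eq_of_subset_of_card_le (fun c hc => ?_)
      (hmin b (Finset.filter_subset _ _ hb))
    exact hmem.2 ((hmem.1 hb).trans (hmem.1 hc))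
  refine ⟨reach a, Finset.filter_subset _ _, ⟨?_, ?_⟩, ?_⟩
  · obtain ⟨b, hb, hab⟩ := hU a ha
    exact ⟨b, hmem.2 (.single ⟨ha, hb, hab⟩)⟩
  · intro b hb c hc
    rw [← heq b hb, hmem] at hc
    induction hc with
    -- The paths are walks in `U`; all their vertices are reachable from `b`, so they stay in `reach
    -- a`, as a loop requires.
    | single h => exact .single ⟨hb, (heq b hb) ▸ hmem.2 (.single h), h.2.2⟩
    | tail h1 h2 ih =>
      exact .tail ih ⟨(heq b hb) ▸ hmem.2 h1, (heq b hb) ▸ hmem.2 (.tail h1 h2), h2.2.2⟩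
  · intro b hb c hc hbc
    exact hmem.2 (.tail (hmem.1 hb) ⟨Finset.filter_subset _ _ hb, hc, hbc⟩)

/-! ### The encoding characterizes the well-founded model -/

namespace DFProgram

variable {P : DFProgram L N H} {ε : Database.Widths N} {ω : P.db.Val}
  {Q E : Finset (GAtom L N H)} {hfin : (P.relevantTo Q E).rules.Finite}

theorem mem_relevant_rules {c : Clause L N H} :
    c ∈ hfin.toFinset ↔ c ∈ P.rules ∧ P.Relevant (↑Q ∪ ↑E) (.reg c.head) := by
  rw [Set.Finite.mem_toFinset]; rfl

open Classical in
theorem mem_allAtoms_relevantTo {a : GAtom L N H} :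
    a ∈ Clause.allAtoms hfin.toFinset (Q ∪ E) ↔ P.Relevant (↑Q ∪ ↑E) a := by
  rw [Clause.mem_allAtoms]
  constructor
  · rintro (ha | ⟨c, hc, rfl | ⟨l, hl, rfl⟩⟩)
    · exact .start (by simpa using ha)
    · exact (mem_relevant_rules.1 hc).2
    · exact .step (mem_relevant_rules.1 hc).2 (mem_relevant_rules.1 hc).1 hl
  · intro h
    induction h with
    | start h => exact .inl (by simpa using h)
    | step h hc hl _ => exact .inr ⟨_, mem_relevant_rules.2 ⟨hc, h⟩, .inr ⟨_, hl, rfl⟩⟩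

open Classical in
-- Completion is the fixed-point equation, and the loop formulas are instances of external support.
-- Backward chaining keeps every clause of a relevant atom, so passing to the relevant program loses
-- no support.
theorem sat_encoding_model (h2 : Rule.TwoValued (P.logicProgram ε ω)) :
    (Clause.encoding hfin.toFinset (Q ∪ E)).Sat (P.model ε ω) := by
  refine Clause.sat_encoding.2 ⟨fun h hh => ?_, fun K hK _ hKM => ?_⟩
  · rw [reg_mem_model h2]
    constructor
    · rintro ⟨c, hc, rfl, hb⟩
      exact ⟨c, mem_relevant_rules.2 ⟨hc, mem_allAtoms_relevantTo.1 hh⟩, rfl, hb⟩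
    · rintro ⟨c, hc, hch⟩
      exact ⟨c, (mem_relevant_rules.1 hc).1, hch⟩
  · obtain ⟨h, hh, hM⟩ := hKM
    obtain ⟨c, hc, hcK, hc'⟩ := exists_external_support h2 (K := ↑K) hh hM
    refine ⟨c, mem_relevant_rules.2 ⟨hc, ?_⟩, hcK, hc'⟩
    obtain ⟨c', hc', he⟩ := Finset.mem_image.1 (hK hcK)
    rw [← he]
    exact (mem_relevant_rules.1 hc').2

open Classical in
/-- A model of the encoding agrees with the well-founded model on the relevant atoms as soon as both
agree on the comparison atoms. -/
theorem mem_iff_of_sat_encoding (h2 : Rule.TwoValued (P.logicProgram ε ω))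
    {M : Set (GAtom L N H)} (hM : (Clause.encoding hfin.toFinset (Q ∪ E)).Sat M)
    (hcmp : ∀ κ, .cmp κ ∈ M ↔ .cmp κ ∈ P.model ε ω) {a : GAtom L N H}
    (ha : P.Relevant (↑Q ∪ ↑E) a) : a ∈ M ↔ a ∈ P.model ε ω := by
  obtain ⟨hcomp, hloop⟩ := Clause.sat_encoding.1 hM
  simp only [mem_allAtoms_relevantTo] at hcomp
  -- Irrelevant atoms count as both true and false in `J`, so `wellFoundedModel ≤ J` asserts
  -- something about relevant atoms only. It suffices that `J` is a pre-fixed point.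
  let J : Set (GAtom L N H) × Set (GAtom L N H) :=
    ({a | P.Relevant (↑Q ∪ ↑E) a → a ∈ M}, {a | P.Relevant (↑Q ∪ ↑E) a → a ∉ M})
  have hT : ∀ l : Lit (GAtom L N H), P.Relevant (↑Q ∪ ↑E) l.atom →
      (Rule.litTrue J l ↔ (l.atom ∈ M ↔ l.sign = true)) := by
    intro l hl
    simp only [Rule.litTrue, J, Set.mem_ofPred_eq, hl, true_imp_iff]
    cases l.sign <;> simp
  have hF : ∀ l : Lit (GAtom L N H), P.Relevant (↑Q ∪ ↑E) l.atom →
      (Rule.litFalse J l ↔ ¬ (l.atom ∈ M ↔ l.sign = true)) := by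
    intro l hl
    simp only [Rule.litFalse, J, Set.mem_ofPred_eq, hl, true_imp_iff]
    cases l.sign <;> simp
  have hle : Rule.wellFoundedModel (P.logicProgram ε ω) ≤ J := by
    refine OrderHom.lfp_le _ ⟨?_, ?_⟩
    · rintro _ ⟨r, ⟨κ, hκ, rfl⟩ | ⟨c, hc, rfl⟩, rfl, hb⟩ hrel
      · exact (hcmp κ).2 ((P.cmp_mem_model).2 hκ)
      · refine (hcomp _ hrel).2 ⟨c, mem_relevant_rules.2 ⟨hc, hrel⟩, rfl, fun l hl => ?_⟩
        exact (hT l (.step hrel hc hl)).1 (hb l hl)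
    · rintro a ⟨U, hU, haU⟩ hrel haM
      -- the atoms that violate the claim
      let V : Finset H := (hfin.toFinset.image Clause.head).filter fun h =>
        GAtom.reg h ∈ U ∧ GAtom.reg h ∈ M
      have hVmem : ∀ h, P.Relevant (↑Q ∪ ↑E) (.reg h) → GAtom.reg h ∈ U → GAtom.reg h ∈ M →
          h ∈ V := by
        intro h hr hhU hhM
        obtain ⟨c, hc, hch, -⟩ := (hcomp h hr).1 hhM
        exact Finset.mem_filter.2 ⟨Finset.mem_image.2 ⟨c, hc, hch⟩, hhU, hhM⟩
      have hnocmp : ∀ κ, GAtom.cmp κ ∈ U → GAtom.cmp κ ∉ M := by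
        intro κ hκU hκM
        rw [hcmp, cmp_mem_model] at hκM
        rcases hU _ (.inl ⟨κ, hκM, rfl⟩) hκU with ⟨l, hl, -⟩ | ⟨l, hl, -⟩ <;> cases hl
      -- Unfoundedness of `U` offers a false body literal or a positive one in `U`. A body true in
      -- `M` excludes the first, and the second is a regular atom in `U` and `M`.
      have hint : ∀ c ∈ hfin.toFinset, c.head ∈ V → c.BodyHolds M →
          ∃ b ∈ V, ∃ l ∈ c.body, l.sign = true ∧ l.atom = .reg b := by
        intro c hc hcV hb
        obtain ⟨hcP, hcr⟩ := mem_relevant_rules.1 hc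
        rcases hU _ (.inr ⟨c, hcP, rfl⟩) (Finset.mem_filter.1 hcV).2.1 with
          ⟨l, hl, hlf⟩ | ⟨l, hl, hs, hlU⟩
        · exact absurd (hb l hl) ((hF l (.step hcr hcP hl)).1 hlf)
        · have hlM := (hb l hl).2 hs
          have hlr : P.Relevant (↑Q ∪ ↑E) l.atom := .step hcr hcP hl
          rcases hla : l.atom with b | κ
          · rw [hla] at hlU hlM hlr
            exact ⟨b, hVmem b hlr hlU hlM, l, hl, hs, hla⟩
          · rw [hla] at hlU hlM
            exact absurd hlM (hnocmp κ hlU)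
      have hVrel : ∀ h ∈ V, P.Relevant (↑Q ∪ ↑E) (.reg h) := by
        intro h hh
        obtain ⟨c, hc, rfl⟩ := Finset.mem_image.1 (Finset.mem_filter.1 hh).1
        exact (mem_relevant_rules.1 hc).2
      have hVne : V.Nonempty := by
        rcases a with h | κ
        · exact ⟨h, hVmem h hrel haU haM⟩
        · exact absurd haM (hnocmp κ haU)
      -- The loop formula of a terminal loop `K` in `V` yields a clause with a true body that uses
      -- no atom of `K` positively. By `hint` it uses an atom of `V` positively, and terminality
      -- puts that atom in `K`.
      obtain ⟨K, hKV, hKloop, hKout⟩ := Clause.exists_terminal_loop (R := hfin.toFinset) hVne (by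
        intro h hh
        obtain ⟨c, hc, rfl, hb⟩ := (hcomp h (hVrel h hh)).1 (Finset.mem_filter.1 hh).2.2
        obtain ⟨b, hbV, hl⟩ := hint c hc hh hb
        exact ⟨b, hbV, c, hc, rfl, hl⟩)
      obtain ⟨k, hk⟩ := hKloop.1
      obtain ⟨c, hc, hcK, hext, hb⟩ := hloop K (fun h hh => by
        convert (Finset.mem_filter.1 (hKV hh)).1) hKloop
        ⟨k, hk, (Finset.mem_filter.1 (hKV hk)).2.2⟩
      obtain ⟨b, hbV, l, hl, hs, hlb⟩ := hint c hc (hKV hcK) hb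
      exact hext l hl hs b (hKout _ hcK b hbV ⟨c, hc, rfl, l, hl, hs, hlb⟩) hlb
  constructor
  · intro haM
    by_contra hn
    exact hle.2 ((mem_wellFoundedModel_snd h2).2 hn) ha haM
  · intro h
    exact hle.1 h ha

end DFProgram

/-! ### Existence of admissible samples and uniqueness of the joint law -/

namespace Database

variable {D : Database L N}

theorem measurable_ext : Measurable D.ext := by
  refine measurable_pi_iff.2 fun m => ?_
  by_cases h : m ∈ D.vars
  · simp only [ext, dif_pos h]; exact measurable_pi_apply _
  · simp only [ext, dif_neg h]; exact measurable_const

/-- The distribution of `ν` is well-defined when the random variables have the values `x`. -/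
def Defined (D : Database L N) (ν : N) (x : N → ℝ) : Prop :=
  (D.dist ν).vals x ∈ L.dom (D.dist ν).functor (D.dist ν).n

open Classical in
-- `L.law` is known to be a measurable family of probability measures only on the domain of the
-- functor. The sampler supplies a Markov kernel on all of `N → ℝ` that agrees with it there.
theorem WellDefined.exists_kernel (hD : D.WellDefined) (ν : D.vars) :
    ∃ κ : ProbabilityTheory.Kernel (N → ℝ) ℝ, ProbabilityTheory.IsMarkovKernel κ ∧
      ∀ x, D.Defined ν x → κ x = D.law ν x := by
  obtain ⟨f, hf, hfl⟩ := hD.exists_sampler ν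
  have hfx : ∀ x, Measurable (f x) := fun x => hf.of_uncurry_left
  let κ : ProbabilityTheory.Kernel (N → ℝ) ℝ :=
    ⟨fun x => volume.map (f x), by
      refine Measure.measurable_of_measurable_coe _ fun B hB => ?_
      have : (fun x => volume.map (f x) B) =
          fun x => volume (Prod.mk x ⁻¹' (Function.uncurry f ⁻¹' B)) := by
        funext x
        rw [Measure.map_apply (hfx x) hB]
        rfl
      rw [this]
      exact measurable_measure_prodMk_left (hf hB)⟩
  refine ⟨κ, ⟨fun x => ?_⟩, hfl⟩
  exact Measure.isProbabilityMeasure_map (hfx x).aemeasurable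

open Classical in
/-- Values on a finite set of random variables as a function on all terms. -/
noncomputable def extFinset (S : Finset D.vars) (s : S → ℝ) : N → ℝ :=
  fun m => if h : ∃ hm : m ∈ D.vars, (⟨m, hm⟩ : D.vars) ∈ S then s ⟨⟨m, h.1⟩, h.2⟩ else 0

theorem measurable_extFinset (S : Finset D.vars) : Measurable (extFinset S) := by
  refine measurable_pi_iff.2 fun m => ?_
  by_cases h : ∃ hm : m ∈ D.vars, (⟨m, hm⟩ : D.vars) ∈ S
  · simp only [extFinset, dif_pos h]; exact measurable_pi_apply _
  · simp only [extFinset, dif_neg h]; exact measurable_const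

theorem WellDefined.vals_extFinset (hD : D.WellDefined) {ν : D.vars} {S : Finset D.vars}
    (hp : ∀ p : D.vars, D.Parent p ν → p ∈ S) (ω : D.Val) :
    (D.dist ν).vals (extFinset S (S.restrict ω)) = (D.dist ν).vals (D.ext ω) := by
  refine DistTerm.vals_congr _ fun m hm => ?_
  have hmv := hD.closed ν ν.2 m hm
  have h : ∃ hm : m ∈ D.vars, (⟨m, hm⟩ : D.vars) ∈ S := ⟨hmv, hp ⟨m, hmv⟩ ⟨hmv, ν.2, hm⟩⟩
  simp only [extFinset, dif_pos h, ext, dif_pos hmv, Finset.restrict]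

theorem law_congr {ν : N} {x y : N → ℝ} (h : (D.dist ν).vals x = (D.dist ν).vals y) :
    D.law ν x = D.law ν y := by
  simp only [law, h]

/-- A set of random variables that contains the parents of its elements. -/
def ParentClosed (S : Finset D.vars) : Prop := ∀ c ∈ S, ∀ p : D.vars, D.Parent p c → p ∈ S

/-- The chain rule is this equality tested on rectangles, which determine finite measures on a
product. The kernel may be read off the values on `S` alone because `S` contains the parents of `ν`.
-/
theorem IsJointLaw.map_restrict_prod {P : Measure D.Val} (hP : D.IsJointLaw P)
    (hD : D.WellDefined) {ν : D.vars} {S : Finset D.vars} (hS : ParentClosed S)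
    (hp : ∀ p : D.vars, D.Parent p ν → p ∈ S) (hν : ν ∉ S)
    (hdef : ∀ᵐ ω ∂P, D.Defined ν (D.ext ω))
    {κ : ProbabilityTheory.Kernel (N → ℝ) ℝ} [ProbabilityTheory.IsMarkovKernel κ]
    (hκ : ∀ x, D.Defined ν x → κ x = D.law ν x) :
    P.map (fun ω => (S.restrict ω, ω ν)) =
      (P.map S.restrict) ⊗ₘ (κ.comap (extFinset S) (measurable_extFinset S)) := by
  have := hP.prob
  have hrm : Measurable (S.restrict : D.Val → S → ℝ) := Finset.measurable_restrict S
  have hpm : Measurable fun ω : D.Val => (S.restrict ω, ω ν) :=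
    hrm.prodMk (measurable_pi_apply ν)
  have := Measure.isProbabilityMeasure_map (μ := P) hrm.aemeasurable
  have := Measure.isProbabilityMeasure_map (μ := P) hpm.aemeasurable
  refine Measure.ext_prod fun {U B} hU hB => ?_
  rw [Measure.map_apply hpm (hU.prod hB), Measure.compProd_apply_prod hU hB,
    setLIntegral_map hU (ProbabilityTheory.Kernel.measurable_coe _ hB) hrm]
  refine (hP.chain ν S hS hp hν U B hU hB).trans ?_
  refine lintegral_congr_ae (ae_restrict_of_ae ?_)
  filter_upwards [hdef] with ω hω
  have he := hD.vals_extFinset hp ω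
  rw [ProbabilityTheory.Kernel.comap_apply, hκ, law_congr he]
  rw [Defined, he]
  exact hω

theorem WellDefined.finite_setOf_ancestor (hD : D.WellDefined) (ν : D.vars) :
    {a : D.vars | D.Ancestor a ν}.Finite :=
  (hD.finite_ancestors ν ν.2).preimage Subtype.val_injective.injOn

theorem Ancestor.mem_vars {a c : N} (h : D.Ancestor a c) : a ∈ D.vars := by
  obtain ⟨b, hab, -⟩ := Relation.TransGen.head'_iff.1 h
  exact hab.1

/-- The number of ancestors serves as the rank for the inductions over random variables. -/
theorem WellDefined.ncard_ancestors_lt (hD : D.WellDefined) {p c : D.vars}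
    (hpc : D.Ancestor p c) : {a | D.Ancestor a p}.ncard < {a | D.Ancestor a c}.ncard := by
  refine Set.ncard_lt_ncard ?_ (hD.finite_ancestors c c.2)
  refine ⟨fun a ha => Relation.TransGen.trans ha hpc, fun hsub => ?_⟩
  exact hD.acyclic p p.2 (hsub hpc)

/-- Both claims are proved in one induction over the ancestors. If the ancestors lie in their sample
spaces, then the distribution of `ν` is defined; the chain rule then draws `ν` from a law carried by
its sample space. -/
theorem IsJointLaw.ae_mem_space_and_defined {P : Measure D.Val} (hP : D.IsJointLaw P)
    (hD : D.WellDefined) (ν : D.vars) :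
    (∀ᵐ ω ∂P, ω ν ∈ D.space ν (D.ext ω)) ∧ ∀ᵐ ω ∂P, D.Defined ν (D.ext ω) := by
  have := hP.prob
  induction h : {a | D.Ancestor a ν}.ncard using Nat.strong_induction_on generalizing ν with
  | _ n ih =>
  subst h
  have hdef : ∀ᵐ ω ∂P, D.Defined ν (D.ext ω) := by
    have hanc : ∀ a ∈ {a | D.Ancestor a ν}, ∀ᵐ ω ∂P, D.ext ω a ∈ D.space a (D.ext ω) := by
      intro a ha
      have hav := Ancestor.mem_vars ha
      filter_upwards [(ih _ (hD.ncard_ancestors_lt (p := ⟨a, hav⟩) ha) ⟨a, hav⟩ rfl).1] with ω hω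
      simpa only [ext, dif_pos hav] using hω
    filter_upwards [(ae_ball_iff (hD.finite_ancestors ν ν.2).countable).2 hanc] with ω hω
    exact hD.dist_defined ν ν.2 _ hω
  refine ⟨?_, hdef⟩
  obtain ⟨κ, hκm, hκ⟩ := hD.exists_kernel ν
  let S : Finset D.vars := (hD.finite_setOf_ancestor ν).toFinset
  have hSm : ∀ p : D.vars, p ∈ S ↔ D.Ancestor p ν := fun p => by simp [S]
  have hp : ∀ p : D.vars, D.Parent p ν → p ∈ S := fun p hp => (hSm p).2 (.single hp)
  have hprod := hP.map_restrict_prod hD (S := S)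
    (fun c hc p hpc => (hSm p).2 (Relation.TransGen.head hpc ((hSm c).1 hc)))
    hp (fun h => hD.acyclic ν ν.2 ((hSm ν).1 h)) hdef hκ
  have hrm : Measurable (S.restrict : D.Val → S → ℝ) := Finset.measurable_restrict S
  have hpm : Measurable fun ω : D.Val => (S.restrict ω, ω ν) :=
    hrm.prodMk (measurable_pi_apply ν)
  have := Measure.isProbabilityMeasure_map (μ := P) hrm.aemeasurable
  have hvm : Measurable fun s : S → ℝ => (D.dist ν).vals (extFinset S s) :=
    (hD.dist_measurable ν ν.2).comp (measurable_extFinset S)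
  -- Definedness is part of `W` because the sample spaces are jointly measurable only over the
  -- domain of the functor.
  let W : Set ((S → ℝ) × ℝ) := {w | D.Defined ν (extFinset S w.1) ∧
    w.2 ∈ D.space ν (extFinset S w.1)}
  have hW : MeasurableSet W :=
    ((hvm.comp measurable_fst).prodMk measurable_snd) (L.measurableSet_space _ _)
  have hae : ∀ᵐ w ∂(P.map fun ω => (S.restrict ω, ω ν)), w ∈ W := by
    rw [hprod]
    refine Measure.ae_compProd_of_ae_ae hW ?_
    have hm : MeasurableSet {s : S → ℝ | D.Defined ν (extFinset S s)} :=
      hvm (L.measurableSet_dom _ _)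
    have hdef' : ∀ᵐ s ∂(P.map S.restrict), D.Defined ν (extFinset S s) := by
      refine (ae_map_iff hrm.aemeasurable hm).2 ?_
      filter_upwards [hdef] with ω hω
      rw [Defined, hD.vals_extFinset hp ω]; exact hω
    filter_upwards [hdef'] with s hs
    rw [ProbabilityTheory.Kernel.comap_apply, hκ _ hs, ae_iff]
    simp only [W, Set.mem_ofPred_eq, hs, true_and]
    exact L.law_space _ _ _ hs
  filter_upwards [ae_of_ae_map hpm.aemeasurable hae] with ω hω
  have := hω.2
  rw [space, hD.vals_extFinset hp ω] at this
  exact this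

theorem IsJointLaw.ae_admissible {P : Measure D.Val} (hP : D.IsJointLaw P)
    (hD : D.WellDefined) : ∀ᵐ ω ∂P, D.Admissible ω := by
  have := hD.countable.to_subtype
  exact ae_all_iff.2 fun ν => (hP.ae_mem_space_and_defined hD ν).1

/-- Induction on the size of `S`: the last variable in a topological order is removed, and the chain
rule recovers the law on `S` from the law on the rest. -/
theorem IsJointLaw.map_restrict_unique {P P' : Measure D.Val} (hP : D.IsJointLaw P)
    (hP' : D.IsJointLaw P') (hD : D.WellDefined) {S : Finset D.vars} (hS : ParentClosed S) :
    P.map S.restrict = P'.map S.restrict := by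
  classical
  have := hP.prob
  have := hP'.prob
  have hrm : ∀ S : Finset D.vars, Measurable (S.restrict : D.Val → S → ℝ) :=
    Finset.measurable_restrict
  induction h : S.card generalizing S with
  | zero =>
    obtain rfl := Finset.card_eq_zero.1 h
    have := Measure.isProbabilityMeasure_map (μ := P) (hrm ∅).aemeasurable
    have := Measure.isProbabilityMeasure_map (μ := P') (hrm ∅).aemeasurable
    ext U -
    rcases Set.eq_empty_or_nonempty U with rfl | hU
    · simp
    · rw [Subsingleton.eq_univ_of_nonempty hU]
      exact measure_univ.trans measure_univ.symm
  | succ n ih =>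
    -- A variable with the most ancestors is a parent of no element of `S`, so `S.erase ν` is still
    -- closed under parents.
    obtain ⟨ν, hν, hmax⟩ := S.exists_max_image (fun ν : D.vars => {a | D.Ancestor a ν}.ncard)
      (Finset.card_pos.1 (by omega))
    have hcl : ParentClosed (S.erase ν) := by
      intro c hc p hpc
      refine Finset.mem_erase.2 ⟨?_, hS c (Finset.mem_of_mem_erase hc) p hpc⟩
      rintro rfl
      exact (hmax c (Finset.mem_of_mem_erase hc)).not_gt (hD.ncard_ancestors_lt (.single hpc))
    have hp : ∀ p : D.vars, D.Parent p ν → p ∈ S.erase ν := by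
      intro p hpc
      refine Finset.mem_erase.2 ⟨?_, hS ν hν p hpc⟩
      rintro rfl
      exact hD.acyclic p p.2 (.single hpc)
    obtain ⟨κ, hκm, hκ⟩ := hD.exists_kernel ν
    have h1 := hP.map_restrict_prod hD hcl hp (S.notMem_erase ν)
      (hP.ae_mem_space_and_defined hD ν).2 hκ
    have h2 := hP'.map_restrict_prod hD hcl hp (S.notMem_erase ν)
      (hP'.ae_mem_space_and_defined hD ν).2 hκ
    rw [ih hcl (by rw [Finset.card_erase_of_mem hν, h]; rfl), ← h2] at h1
    let g : ((S.erase ν) → ℝ) × ℝ → S → ℝ := fun w i =>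
      if hi : i.1 = ν then w.2 else w.1 ⟨i.1, Finset.mem_erase.2 ⟨hi, i.2⟩⟩
    have hg : Measurable g := by
      refine measurable_pi_iff.2 fun i => ?_
      by_cases hi : i.1 = ν
      · simp only [g, dif_pos hi]; exact measurable_snd
      · simp only [g, dif_neg hi]; exact (measurable_pi_apply _).comp measurable_fst
    have hgr : (S.restrict : D.Val → S → ℝ) = g ∘ fun ω => ((S.erase ν).restrict ω, ω ν) := by
      funext ω i
      by_cases hi : i.1 = ν
      · simp [g, ← hi]
      · simp [g, dif_neg hi]
    have hpm : Measurable fun ω : D.Val => ((S.erase ν).restrict ω, ω ν) :=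
      (hrm _).prodMk (measurable_pi_apply ν)
    rw [hgr, ← Measure.map_map hg hpm, h1, Measure.map_map hg hpm]

/-- A well-defined database has only one joint law. -/
theorem IsJointLaw.unique {P P' : Measure D.Val} (hP : D.IsJointLaw P)
    (hP' : D.IsJointLaw P') (hD : D.WellDefined) : P = P' := by
  classical
  have := hP.prob
  have := hP'.prob
  have hrm : ∀ S : Finset D.vars, Measurable (S.restrict : D.Val → S → ℝ) :=
    Finset.measurable_restrict
  have hall : ∀ T : Finset D.vars, P.map T.restrict = P'.map T.restrict := by
    intro T
    -- Finitely many ancestors per variable give a finite parent-closed set around any `T`; the law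
    -- on `T` is a marginal of the law on it.
    let S : Finset D.vars := T ∪ T.biUnion fun c => (hD.finite_setOf_ancestor c).toFinset
    have hS : ParentClosed S := by
      intro c hc p hpc
      simp only [S, Finset.mem_union, Finset.mem_biUnion, Set.Finite.mem_toFinset,
        Set.mem_ofPred_eq] at hc ⊢
      rcases hc with hc | ⟨c', hc', hcc'⟩
      · exact .inr ⟨c, hc, .single hpc⟩
      · exact .inr ⟨c', hc', .head hpc hcc'⟩
    have hTS : T ⊆ S := Finset.subset_union_left
    have h := congrArg (Measure.map (Finset.restrict₂ (π := fun _ => ℝ) hTS))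
      (hP.map_restrict_unique hP' hD hS)
    have hm : Measurable (Finset.restrict₂ (π := fun _ : D.vars => ℝ) hTS) :=
      Finset.measurable_restrict₂ hTS
    rwa [Measure.map_map hm (hrm S), Measure.map_map hm (hrm S)] at h
  have : ∀ T : Finset D.vars, IsFiniteMeasure (P'.map T.restrict) := fun T =>
    by
    have := Measure.isProbabilityMeasure_map (μ := P') (hrm T).aemeasurable
    infer_instance
  exact IsProjectiveLimit.unique (P := fun T : Finset D.vars => P'.map T.restrict) hall
    fun T => rfl

theorem WellDefined.isJointLaw_jointLaw (hD : D.WellDefined) : D.IsJointLaw D.jointLaw := by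
  rw [jointLaw, dif_pos hD.exists_isJointLaw]
  exact hD.exists_isJointLaw.choose_spec

/-! ### Parts of a database -/

/-- `D'` is the restriction of `D` to a set of random variables that is closed under parents. -/
structure IsClosedPart (D' D : Database L N) : Prop where
  dist_eq : D'.dist = D.dist
  vars_subset : D'.vars ⊆ D.vars
  closed : ∀ ν ∈ D'.vars, ∀ p ∈ (D.dist ν).terms, p ∈ D.vars → p ∈ D'.vars

/-- The restriction of a value assignment to fewer random variables. -/
def restrictVal {D' : Database L N} (h : D'.vars ⊆ D.vars) (ω : D.Val) : D'.Val :=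
  fun ν => ω ⟨ν, h ν.2⟩

theorem measurable_restrictVal {D' : Database L N} (h : D'.vars ⊆ D.vars) :
    Measurable (restrictVal h) :=
  measurable_pi_iff.2 fun _ => measurable_pi_apply _

theorem ext_restrictVal {D' : Database L N} (h : D'.vars ⊆ D.vars) (ω : D.Val) {m : N}
    (hm : m ∈ D'.vars) : D'.ext (restrictVal h ω) m = D.ext ω m := by
  simp only [ext, dif_pos hm, dif_pos (h hm), restrictVal]

namespace IsClosedPart

variable {D' : Database L N}

theorem parent_iff (h : D'.IsClosedPart D) {p c : N} :
    D'.Parent p c ↔ D.Parent p c ∧ c ∈ D'.vars := by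
  simp only [Parent, h.dist_eq]
  constructor
  · rintro ⟨hp, hc, ht⟩
    exact ⟨⟨h.vars_subset hp, h.vars_subset hc, ht⟩, hc⟩
  · rintro ⟨⟨hp, -, ht⟩, hc⟩
    exact ⟨h.closed c hc p ht hp, hc, ht⟩

/-- A chain of parents that ends in the part never leaves it, since the part is closed under
parents. -/
theorem ancestor_iff (h : D'.IsClosedPart D) {a c : N} (hc : c ∈ D'.vars) :
    D'.Ancestor a c ↔ D.Ancestor a c := by
  constructor
  · exact fun hac => hac.lift id fun _ _ hpc => (h.parent_iff.1 hpc).1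
  · intro hac
    induction hac with
    | single hp => exact .single (h.parent_iff.2 ⟨hp, hc⟩)
    | tail _ hp ih =>
      have hp' := h.parent_iff.2 ⟨hp, hc⟩
      exact .tail (ih hp'.1) hp'

theorem wellDefined (h : D'.IsClosedPart D) (hD : D.WellDefined) : D'.WellDefined where
  countable := hD.countable.mono h.vars_subset
  closed ν hν p hp := by
    rw [h.dist_eq] at hp
    exact h.closed ν hν p hp (hD.closed ν (h.vars_subset hν) p hp)
  finite_ancestors ν hν := by
    simp only [h.ancestor_iff hν]
    exact hD.finite_ancestors ν (h.vars_subset hν)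
  acyclic ν hν := by
    rw [h.ancestor_iff hν]
    exact hD.acyclic ν (h.vars_subset hν)
  dist_defined ν hν ω hω := by
    rw [h.dist_eq]
    refine hD.dist_defined ν (h.vars_subset hν) ω fun a ha => ?_
    have := hω a ((h.ancestor_iff hν).2 ha)
    rwa [space, h.dist_eq] at this
  dist_measurable ν hν := by
    rw [h.dist_eq]
    exact hD.dist_measurable ν (h.vars_subset hν)

theorem vals_ext_restrictVal (h : D'.IsClosedPart D) (hD : D.WellDefined) {ν : N}
    (hν : ν ∈ D'.vars) (ω : D.Val) :
    (D.dist ν).vals (D'.ext (restrictVal h.vars_subset ω)) = (D.dist ν).vals (D.ext ω) :=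
  DistTerm.vals_congr _ fun p hp => ext_restrictVal _ _
    (h.closed ν hν p hp (hD.closed ν (h.vars_subset hν) p hp))

/-- The marginal of the joint law on a part that is closed under parents is a joint law. -/
theorem isJointLaw_map (h : D'.IsClosedPart D) (hD : D.WellDefined) {P : Measure D.Val}
    (hP : D.IsJointLaw P) : D'.IsJointLaw (P.map (restrictVal h.vars_subset)) := by
  classical
  have := hP.prob
  have hr := measurable_restrictVal h.vars_subset
  refine ⟨Measure.isProbabilityMeasure_map hr.aemeasurable, fun ν S hS hp hν U B hU hB => ?_⟩
  have hrm : Measurable (S.restrict : D'.Val → S → ℝ) := Finset.measurable_restrict S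
  have hpv : Measurable fun ω : D'.Val => ω ν := measurable_pi_apply ν
  let ι : D'.vars ↪ D.vars := ⟨Set.inclusion h.vars_subset, Set.inclusion_injective _⟩
  let g : (S.map ι → ℝ) → S → ℝ := fun s i => s ⟨ι i, Finset.mem_map_of_mem ι i.2⟩
  have hg : Measurable g := measurable_pi_iff.2 fun i => measurable_pi_apply _
  have hchain := hP.chain (ι ν) (S.map ι) (by
      intro c hc p hpc
      obtain ⟨c, hcS, rfl⟩ := Finset.mem_map.1 hc
      have hpc' := h.parent_iff.2 ⟨hpc, c.2⟩
      exact Finset.mem_map.2 ⟨⟨p, hpc'.1⟩, hS c hcS ⟨p, hpc'.1⟩ hpc', rfl⟩) (by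
      intro p hpν
      have hpν' := h.parent_iff.2 ⟨hpν, ν.2⟩
      exact Finset.mem_map.2 ⟨⟨p, hpν'.1⟩, hp ⟨p, hpν'.1⟩ hpν', rfl⟩)
    (by simpa using hν) (g ⁻¹' U) B (hg hU) hB
  -- The change of variables needs an integrand that is measurable everywhere, so `κ` stands in for
  -- the law, with which it agrees almost surely.
  obtain ⟨κ, hκm, hκ⟩ := hD.exists_kernel (ι ν)
  have hdef : ∀ᵐ ω ∂P, D.Defined ν (D.ext ω) := (hP.ae_mem_space_and_defined hD (ι ν)).2
  have hdef' : ∀ᵐ ω ∂(P.map (restrictVal h.vars_subset)), D.Defined ν (D'.ext ω) := by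
    have hm : MeasurableSet {ω : D'.Val | D.Defined ν (D'.ext ω)} :=
      ((hD.dist_measurable ν (h.vars_subset ν.2)).comp measurable_ext) (L.measurableSet_dom _ _)
    refine (ae_map_iff hr.aemeasurable hm).2 ?_
    filter_upwards [hdef] with ω hω
    rw [Defined, h.vals_ext_restrictVal hD ν.2]
    exact hω
  have hlaw : ∀ x, D'.law ν x = D.law ν x := fun x => by rw [law, law, h.dist_eq]
  have hA : MeasurableSet {ω : D'.Val | S.restrict ω ∈ U} := hrm hU
  refine (Measure.map_apply hr (hA.inter (hpv hB))).trans (hchain.trans ?_)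
  have e1 : ∫⁻ ω in {ω | S.restrict ω ∈ U}, D'.law ν (D'.ext ω) B
      ∂(P.map (restrictVal h.vars_subset)) =
      ∫⁻ ω in {ω | S.restrict ω ∈ U}, κ (D'.ext ω) B ∂(P.map (restrictVal h.vars_subset)) := by
    refine lintegral_congr_ae (ae_restrict_of_ae ?_)
    filter_upwards [hdef'] with ω hω
    rw [hlaw, hκ _ hω]
    rfl
  have e2 := setLIntegral_map (μ := P) hA
    ((ProbabilityTheory.Kernel.measurable_coe κ hB).comp measurable_ext) hr
  rw [e1]
  refine Eq.trans ?_ e2.symm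
  refine lintegral_congr_ae (ae_restrict_of_ae ?_)
  filter_upwards [hdef] with ω hω
  have he := h.vals_ext_restrictVal hD ν.2 ω
  have hω' : D.Defined ν (D'.ext (restrictVal h.vars_subset ω)) := by
    rw [Defined, he]; exact hω
  rw [Function.comp_apply, hκ _ hω']
  exact congrArg (· B) (law_congr he.symm)

/-- `jointLaw` is an arbitrary choice for each database; uniqueness makes the choices compatible. -/
theorem map_jointLaw (h : D'.IsClosedPart D) (hD : D.WellDefined) :
    D.jointLaw.map (restrictVal h.vars_subset) = D'.jointLaw :=
  (h.isJointLaw_map hD hD.isJointLaw_jointLaw).unique (h.wellDefined hD).isJointLaw_jointLaw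
    (h.wellDefined hD)

end IsClosedPart

theorem isClosedPart_ancestral (D : Database L N) (S : Set N) :
    (D.ancestral S).IsClosedPart D where
  dist_eq := rfl
  vars_subset _ h := h.1
  closed := by
    rintro ν ⟨hν, h⟩ p hp hpv
    have hpar : D.Parent p ν := ⟨hpv, hν, hp⟩
    refine ⟨hpv, .inr ?_⟩
    rcases h with h | ⟨c, hc, h⟩
    · exact ⟨ν, h, .single hpar⟩
    · exact ⟨c, hc, .head hpar h⟩

theorem isClosedPart_ancestral_ancestral (D : Database L N) {S S' : Set N} (hS : S ⊆ S') :
    (D.ancestral S).IsClosedPart (D.ancestral S') where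
  dist_eq := rfl
  vars_subset _ h := ⟨h.1, h.2.imp (hS ·) fun ⟨c, hc, h⟩ => ⟨c, hS hc, h⟩⟩
  closed ν hν p hp hpv := (D.isClosedPart_ancestral S).closed ν hν p hp hpv.1

theorem subset_ancestral_vars {S : Set N} {ν : N} (hν : ν ∈ D.vars) (hS : ν ∈ S) :
    ν ∈ (D.ancestral S).vars := ⟨hν, .inl hS⟩

/-! ### Comparison atoms on parts of a database, and integrability of labels -/

/-- A delta atom depends on its variable and also, through countability of the sample space, on the
arguments of its distribution; hence the second condition. -/
theorem holds_congr {ε : Widths N} {x y : N → ℝ} {κ : CAtom L N}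
    (h : ∀ ν ∈ κ.terms, x ν = y ν ∧ (D.dist ν).vals x = (D.dist ν).vals y) :
    D.Holds ε x κ ↔ D.Holds ε y κ := by
  cases κ with
  | cmp p l r =>
    rw [Holds, Holds, l.eval_congr fun z hz => (h z (List.mem_append_left _ hz)).1,
      r.eval_congr fun z hz => (h z (List.mem_append_right _ hz)).1]
  | delta ν w =>
    obtain ⟨h1, h2⟩ := h ν (by simp [CAtom.terms])
    simp only [Holds, space, h1, h2]

theorem IsClosedPart.holds_restrictVal {D' : Database L N} (h : D'.IsClosedPart D)
    (hD : D.WellDefined) {ε : Widths N} {κ : CAtom L N} (hκ : ∀ ν ∈ κ.terms, ν ∈ D'.vars)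
    (ω : D.Val) :
    D'.Holds ε (D'.ext (restrictVal h.vars_subset ω)) κ ↔ D.Holds ε (D.ext ω) κ := by
  have : ∀ x, D'.Holds ε x κ ↔ D.Holds ε x κ := by
    intro x
    have hs : D'.space = D.space := by
      funext ν y
      rw [space, space, h.dist_eq]
    cases κ <;> simp only [Holds, hs]
  rw [this]
  exact holds_congr fun ν hν =>
    ⟨ext_restrictVal _ _ (hκ ν hν), h.vals_ext_restrictVal hD (hκ ν hν) ω⟩

/-- A measurable comparison is measurable over its own ancestral part. Restriction to that part
carries one joint law to the other, so null measurability pulls back. -/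
theorem WellDefined.nullMeasurableSet_holds (hD : D.WellDefined) {κ : CAtom L N}
    (hκ : κ ∈ D.comparisons) {S : Set N} (hS : ∀ ν ∈ κ.terms, ν ∈ S) (ε : Widths N) :
    NullMeasurableSet {ω : (D.ancestral S).Val |
      (D.ancestral S).Holds ε ((D.ancestral S).ext ω) κ} (D.ancestral S).jointLaw := by
  have hp := D.isClosedPart_ancestral_ancestral (S := {ν | ν ∈ κ.terms}) hS
  have hD' := (D.isClosedPart_ancestral S).wellDefined hD
  have hq : Measure.QuasiMeasurePreserving (restrictVal hp.vars_subset)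
      (D.ancestral S).jointLaw (D.ancestral {ν | ν ∈ κ.terms}).jointLaw :=
    ⟨measurable_restrictVal _, (hp.map_jointLaw hD').le.absolutelyContinuous⟩
  refine ((hκ.2 ε).preimage hq).congr (Eq.eventuallyEq ?_)
  ext ω
  exact hp.holds_restrictVal hD' (ε := ε) (fun ν hν => ⟨hκ.1 ν hν, .inl hν⟩) ω

/-- The label of a formula over measurable comparisons is an integrable random variable. -/
theorem integrable_labelVar {P : Measure D.Val} [IsFiniteMeasure P] {ε : Widths N}
    {φ : Formula (GAtom L N H)}
    (hφ : ∀ κ, .cmp κ ∈ φ.vars → NullMeasurableSet {ω : D.Val | D.Holds ε (D.ext ω) κ} P) :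
    Integrable (D.labelVar ε φ) P := by
  classical
  refine integrable_finsetSum _ fun M _ => ?_
  simp only [prod_litLabel]
  have hnull : NullMeasurableSet {ω : D.Val | ∀ κ, GAtom.cmp κ ∈ φ.vars →
      (GAtom.cmp κ ∈ M ↔ D.Holds ε (D.ext ω) κ)} P := by
    -- There may be uncountably many comparison atoms; indexing by the variables of `φ` makes the
    -- intersection finite.
    have : {ω : D.Val | ∀ κ, GAtom.cmp κ ∈ φ.vars →
        (GAtom.cmp κ ∈ M ↔ D.Holds ε (D.ext ω) κ)} = ⋂ a ∈ φ.vars, {ω : D.Val |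
          ∀ κ, GAtom.cmp κ = a → (GAtom.cmp κ ∈ M ↔ D.Holds ε (D.ext ω) κ)} := by
      ext ω
      simp only [Set.mem_ofPred_eq, Set.mem_iInter]
      exact ⟨fun h a ha κ hκ => h κ (hκ ▸ ha), fun h κ hκ => h _ hκ κ rfl⟩
    rw [this]
    refine NullMeasurableSet.biInter φ.vars.countable_toSet fun a ha => ?_
    rcases a with h | κ
    · simp
    · by_cases hM : GAtom.cmp κ ∈ M
      · simpa [hM] using hφ κ ha
      · simp only [GAtom.cmp.injEq, forall_eq, hM, false_iff]
        exact (hφ κ ha).compl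
  exact (integrable_const (1 : ℝ)).indicator₀ hnull

end Database

/-! ### Expected labels are probabilities -/

namespace DFProgram

variable {P : DFProgram L N H} {ε : Database.Widths N} {Q E : Finset (GAtom L N H)}

theorem Valid.mem_comparisons (hP : P.Valid ε) {S : Set (GAtom L N H)}
    (hS : ∀ κ, .cmp κ ∈ S → κ ∈ P.db.comparisons) {κ : CAtom L N}
    (hκ : P.Relevant S (.cmp κ)) : κ ∈ P.db.comparisons := by
  generalize ha : (GAtom.cmp κ : GAtom L N H) = a at hκ
  cases hκ with
  | start h => exact hS κ (ha ▸ h)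
  | step _ hc hl => exact hP.comparisons _ hc _ hl κ ha.symm

open Classical in
/-- The label of a formula that entails the encoding of the relevant ground program is integrable,
and its expectation is the probability that the formula holds in the well-founded model. -/
theorem Valid.expectedLabel_eq (hP : P.Valid ε)
    (hQE : ∀ κ, .cmp κ ∈ Q ∨ .cmp κ ∈ E → κ ∈ P.db.comparisons)
    (hfin : (P.relevantTo Q E).rules.Finite) {φ : Formula (GAtom L N H)}
    (hvars : ∀ a ∈ φ.vars, P.Relevant (↑Q ∪ ↑E) a)
    (henc : ∀ M, φ.Sat M → (Clause.encoding hfin.toFinset (Q ∪ E)).Sat M) :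
    Integrable ((P.relevantTo Q E).db.labelVar ε φ) (P.relevantTo Q E).db.jointLaw ∧
      (P.relevantTo Q E).db.expectedLabel ε φ =
        P.db.jointLaw.real {ω | φ.Sat (P.model ε ω)} := by
  have hD := hP.wellDefined
  let S : Set N := {ν | ∃ κ, P.Relevant (↑Q ∪ ↑E) (.cmp κ) ∧ ν ∈ κ.terms}
  have hpart : (P.relevantTo Q E).db.IsClosedPart P.db := P.db.isClosedPart_ancestral S
  have hcomp : ∀ κ, P.Relevant (↑Q ∪ ↑E) (.cmp κ) → κ ∈ P.db.comparisons := fun κ =>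
    hP.mem_comparisons fun κ h => hQE κ (by simpa using h)
  have hprob := hD.isJointLaw_jointLaw.prob
  have hprob' := (hpart.wellDefined hD).isJointLaw_jointLaw.prob
  have hr := Database.measurable_restrictVal hpart.vars_subset
  have hint : Integrable ((P.relevantTo Q E).db.labelVar ε φ) (P.relevantTo Q E).db.jointLaw :=
    Database.integrable_labelVar fun κ hκ => hD.nullMeasurableSet_holds (hcomp κ (hvars _ hκ))
      (S := S) (fun ν hν => ⟨κ, hvars _ hκ, hν⟩) ε
  refine ⟨hint, ?_⟩
  have hlabel : ∀ᵐ ω ∂P.db.jointLaw,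
      (P.relevantTo Q E).db.labelVar ε φ (Database.restrictVal hpart.vars_subset ω) =
        {ω | φ.Sat (P.model ε ω)}.indicator (fun _ => (1 : ℝ)) ω := by
    filter_upwards [hD.isJointLaw_jointLaw.ae_admissible hD] with ω hω
    refine (Database.label_eq_ite _ (W := P.model ε ω) (fun κ hκ => ?_)
      fun M hM hc a ha => ?_).trans ?_
    · have hκc := hcomp κ (hvars _ hκ)
      rw [hpart.holds_restrictVal hD fun ν hν =>
        Database.subset_ancestral_vars (hκc.1 ν hν) ⟨κ, hvars _ hκ, hν⟩, cmp_mem_model]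
      exact and_iff_right hκc
    · exact mem_iff_of_sat_encoding (hP.twoValued ω hω) (henc M hM) hc (hvars a ha)
    · simp only [Set.indicator_apply, Set.mem_ofPred_eq]
  rw [← hpart.map_jointLaw hD] at hint
  -- Measurability of the event is inherited from the label, whose pullback is almost everywhere its
  -- indicator; the well-founded model needs no separate argument.
  have hnull : NullMeasurableSet {ω | φ.Sat (P.model ε ω)} P.db.jointLaw := by
    have hm := (hint.aestronglyMeasurable.aemeasurable.comp_measurable hr).congr hlabel
    exact (aemeasurable_indicator_const_iff (1 : ℝ)).1 hm
  rw [Database.expectedLabel, ← hpart.map_jointLaw hD,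
    integral_map hr.aemeasurable hint.aestronglyMeasurable, integral_congr_ae hlabel,
    integral_indicator₀ hnull]
  simp

/-- For admissible `ω` the model satisfies the encoding, so it satisfies `φ` exactly when the
evidence holds. Thus `Valid.expectedLabel_eq` turns the two expected labels into the denominator and
the numerator of `condProb`. -/
theorem Valid.integrable_and_condProb_eq (hP : P.Valid ε) {e : GAtom L N H → Bool}
    (hQE : ∀ κ, .cmp κ ∈ Q ∨ .cmp κ ∈ E → κ ∈ P.db.comparisons)
    (hfin : (P.relevantTo Q E).rules.Finite) {μ : GAtom L N H} (hμ : μ ∈ Q) (q : Bool)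
    (hE : P.evidenceProb ε E e ≠ 0) :
    Integrable ((P.relevantTo Q E).db.labelVar ε ((P.formula Q E e hfin).and (.lit ⟨μ, q⟩)))
        (P.relevantTo Q E).db.jointLaw ∧
      Integrable ((P.relevantTo Q E).db.labelVar ε (P.formula Q E e hfin))
        (P.relevantTo Q E).db.jointLaw ∧
      (P.relevantTo Q E).db.expectedLabel ε (P.formula Q E e hfin) ≠ 0 ∧
      P.condProb ε μ q E e =
        (P.relevantTo Q E).db.expectedLabel ε ((P.formula Q E e hfin).and (.lit ⟨μ, q⟩)) /
          (P.relevantTo Q E).db.expectedLabel ε (P.formula Q E e hfin) := by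
  classical
  have hvars : ∀ a ∈ (P.formula Q E e hfin).vars, P.Relevant (↑Q ∪ ↑E) a := by
    intro a ha
    rcases Formula.mem_vars_and.1 ha with ha | ha
    · exact mem_allAtoms_relevantTo.1 (Clause.vars_encoding_subset ha)
    · obtain ⟨η, hη, ha⟩ := Formula.mem_vars_bigAnd.1 ha
      rw [Formula.mem_vars_lit.1 ha]
      exact .start (.inr hη)
  have hvars' : ∀ a ∈ ((P.formula Q E e hfin).and (.lit ⟨μ, q⟩)).vars,
      P.Relevant (↑Q ∪ ↑E) a := by
    intro a ha
    rcases Formula.mem_vars_and.1 ha with ha | ha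
    · exact hvars a ha
    · rw [Formula.mem_vars_lit.1 ha]
      exact .start (.inl hμ)
  obtain ⟨h1, e1⟩ := hP.expectedLabel_eq hQE hfin hvars' fun M hM => hM.1.1
  obtain ⟨h2, e2⟩ := hP.expectedLabel_eq hQE hfin hvars fun M hM => hM.1
  have hD := hP.wellDefined.isJointLaw_jointLaw
  have hae : ∀ᵐ ω ∂P.db.jointLaw, (P.formula Q E e hfin).Sat (P.model ε ω) ↔
      ω ∈ P.evidenceEvent ε E e := by
    filter_upwards [hD.ae_admissible hP.wellDefined] with ω hω
    refine Iff.trans (and_iff_right ?_) sat_evidenceFormula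
    exact sat_encoding_model (hP.twoValued ω hω)
  have hae' : ∀ᵐ ω ∂P.db.jointLaw,
      ((P.formula Q E e hfin).and (.lit ⟨μ, q⟩)).Sat (P.model ε ω) ↔
        ω ∈ P.queryEvent ε μ q ∩ P.evidenceEvent ε E e := by
    filter_upwards [hae] with ω hω
    exact (and_congr hω Formula.sat_lit).trans and_comm
  have e2' : (P.relevantTo Q E).db.expectedLabel ε (P.formula Q E e hfin) =
      P.evidenceProb ε E e :=
    e2.trans (measureReal_congr (eventuallyEq_set.2 hae))
  have e1' := e1.trans (measureReal_congr (eventuallyEq_set.2 hae'))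
  refine ⟨h1, h2, e2'.symm ▸ hE, ?_⟩
  rw [e1', e2', condProb]

end DFProgram

end DCProbLog

theorem mainTheorem3 {L : Vocabulary} {T A : Type*} (P : Program L T A)
    (Q E : Finset (DFAtom L (FTerm L T A) A)) (e : DFAtom L (FTerm L T A) A → Bool)
    (hQE : ∀ κ, GAtom.cmp κ ∈ Q ∨ GAtom.cmp κ ∈ E → κ ∈ P.toDF.db.comparisons)
    (hfin : (P.toDF.relevantTo Q E).rules.Finite)
    (μ : DFAtom L (FTerm L T A) A) (hμ : μ ∈ Q) (q : Bool) :
    (∀ ε : Database.Widths (RVar L (FTerm L T A) A), P.Valid ε →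
      P.toDF.evidenceProb ε E e ≠ 0 →
        Integrable
          ((P.toDF.relevantTo Q E).db.labelVar ε ((P.toDF.formula Q E e hfin).and (.lit ⟨μ, q⟩)))
          (P.toDF.relevantTo Q E).db.jointLaw ∧
        Integrable ((P.toDF.relevantTo Q E).db.labelVar ε (P.toDF.formula Q E e hfin))
          (P.toDF.relevantTo Q E).db.jointLaw ∧
        (P.toDF.relevantTo Q E).db.expectedLabel ε (P.toDF.formula Q E e hfin) ≠ 0 ∧
        P.toDF.condProb ε μ q E e =
          (P.toDF.relevantTo Q E).db.expectedLabel ε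
              ((P.toDF.formula Q E e hfin).and (.lit ⟨μ, q⟩)) /
            (P.toDF.relevantTo Q E).db.expectedLabel ε (P.toDF.formula Q E e hfin)) ∧
    (∀ (l : Filter (Database.Widths (RVar L (FTerm L T A) A))) (p : ℝ),
      (∀ᶠ ε in l, P.Valid ε) → P.toDF.IsLimitCondProb l μ q E e p →
        Tendsto (fun ε =>
          (P.toDF.relevantTo Q E).db.expectedLabel ε
              ((P.toDF.formula Q E e hfin).and (.lit ⟨μ, q⟩)) /
            (P.toDF.relevantTo Q E).db.expectedLabel ε (P.toDF.formula Q E e hfin)) l (𝓝 p)) := by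
  have key := fun ε (hv : P.Valid ε) (hE : P.toDF.evidenceProb ε E e ≠ 0) =>
    hv.2.integrable_and_condProb_eq hQE hfin hμ q hE
  -- Along `l` the program is eventually valid and the evidence eventually has nonzero probability,
  -- so the label quotients eventually equal the conditional probabilities whose limit is `p`.
  refine ⟨key, fun l p hv hp => hp.tendsto.congr' ?_⟩
  filter_upwards [hv, hp.possible] with ε hε hE
  exact (key ε hε hE).2.2.2
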